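/- Let $N$ be a finite-dimensional smooth manifold (Hausdorff, $\sigma$-compact), $A=C^\infty(N)$, and let $\lambda\colon\mathcal L\to TN$ be a Lie algebroid: a smooth real vector bundle $\mathcal L$ of finite rank with anchor $\lambda$ and a Lie bracket on its space $L$ of smooth sections satisfying the Leibniz rule $[s,ft]=f[s,t]+\lambda(s)(f)\,t$ and such that $\lambda\colon L\to \mathrm{Vect}(N)$ is a Lie algebra map. Let $L''\subseteq\mathrm{Vect}(N)$ be the image of $L$ and $L'$ the kernel of $L\to L''$. For a Lie–Rinehart algebra $(A,M)$ write $S_A[M]$ for the symmetric $A$-algebra of $M$ with its tautological Poisson bracket over $\mathbb R$, given by $\{x,y\}=[x,y]$, $\{x,a\}=x(a)$, $\{a,b\}=0$ for $x,y\in M$, $a,b\in A$. Suppose that $\lambda$ has constant rank. Then: 1. The image $D=\lambda(\mathcal L)\subseteq TN$ is a smooth involutive subbundle, i.e. the tangent distribution of a foliation, and $L''$ consists of exactly those smooth vector fields on $N$ which are tangent to $D$ at every point. 2. Every smooth function on $N$ which is constant on the leaves (two points lie in the same leaf if they can be joined by finitely many $C^1$ curves tangent to $D$) is a Casimir element of $S_A[L]$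 and of $S_A[L'']$, i.e. has zero bracket with every element. 3. The extension $0\to L'\to L\to L''\to 0$ splits in the category of $A$-modules: there is a connection, i.e. an $A$-linear section $\omega\colon L''\to L$. 4. Let $\omega$ be any such connection, with curvature $\Omega(\alpha,\beta)=[\omega(\alpha),\omega(\beta)]-\omega([\alpha,\beta])\in L'$, an alternating $A$-bilinear map. Identify $L''$ with $\omega(L'')$, so that $L=L'\oplus L''$. Then the tautological bracket is the one and only Poisson bracket over $\mathbb R$ on the commutative algebra $S_A[L]$ such that, for all $\alpha',\beta'\in L'$, $\alpha'',\beta''\in L''$, $a,b\in A$, $$\{\alpha',\beta'\}=[\alpha',\beta'],\qquad \{\alpha'',\beta''\}=[\alpha'',\beta'']+\Omega(\alpha'',\beta''),\qquad \{\alpha'',\beta'\}=[\omega(\alpha''),\beta'],$$ $$\{\alpha'',a\}=\alpha''(a),\qquad \{\alpha',a\}=0,\qquad \{a,b\}=0,$$ where $[\alpha'',\beta'']$ is the bracket of $L''$. 5. Let $\pi\colon\mathcal L^*\to N$ be the dual bundle. The algebra homomorphism from $S_A[L]$ to functions on $\mathcal L^*$ which sends $a\in A$ to $a\circ\pi$ and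 $s\in L$ to $\xi\mapsto \xi(s(\pi(\xi)))$ is injective, and its image is the algebra of all smooth functions on $\mathcal L^*$ whose restrictions to the fibres are polynomials of bounded degree. -/

import Mathlib

/-! ### Poisson brackets and tautological Poisson algebras -/

/-- A Poisson bracket over `R` on a commutative `R`-algebra `S`: an `R`-bilinear Lie bracket
which is a derivation in each variable. -/
structure PoissonBracket (R S : Type*) [CommRing R] [CommRing S] [Algebra R S] where
  br : S →ₗ[R] S →ₗ[R] S
  br_self : ∀ u, br u u = 0
  jacobi : ∀ u v w, br u (br v w) = br (br u v) w + br v (br u w)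
  leibniz : ∀ u v w, br u (v * w) = br u v * w + v * br u w

/-- Elements of `S` which Poisson commute with everything. -/
def PoissonBracket.IsCasimir {R S : Type*} [CommRing R] [CommRing S] [Algebra R S]
    (P : PoissonBracket R S) (c : S) : Prop := ∀ u, P.br c u = 0

namespace LieRinehartAlgebra

section Extend

variable {R A L : Type*} [CommRing R] [CommRing A] [Algebra R A] [AddCommGroup L]
  [Module R L] [Module A L] [IsScalarTower R A L]

/-- A ring homomorphism `φ` on `A` and a `φ`-semilinear map on `L` extend to a ring homomorphism on
the symmetric `A`-algebra of `L`. -/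
noncomputable def symmLift {B : Type*} [CommRing B] (φ : A →+* B) (g : L →+ B)
    (h : ∀ (a : A) (x : L), g (a • x) = φ a * g x) : SymmetricAlgebra A L →+* B :=
  let : Algebra A B := φ.toAlgebra
  (SymmetricAlgebra.lift (R := A)
    { toFun := g
      map_add' := g.map_add
      map_smul' := fun a x => by rw [h, Algebra.smul_def]; rfl }).toRingHom

theorem symmLift_algebraMap {B : Type*} [CommRing B] (φ : A →+* B) (g : L →+ B)
    (h : ∀ (a : A) (x : L), g (a • x) = φ a * g x) (a : A) :
    symmLift φ g h (algebraMap A _ a) = φ a :=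
  let : Algebra A B := φ.toAlgebra
  AlgHom.commutes (SymmetricAlgebra.lift (R := A)
    { toFun := g
      map_add' := g.map_add
      map_smul' := fun a x => by rw [h, Algebra.smul_def]; rfl }) a

theorem symmLift_ι {B : Type*} [CommRing B] (φ : A →+* B) (g : L →+ B)
    (h : ∀ (a : A) (x : L), g (a • x) = φ a * g x) (x : L) :
    symmLift φ g h (SymmetricAlgebra.ι A L x) = g x :=
  let : Algebra A B := φ.toAlgebra
  SymmetricAlgebra.lift_ι_apply
    { toFun := g
      map_add' := g.map_add
      map_smul' := fun a x => by rw [h, Algebra.smul_def]; rfl } x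

theorem exists_derivation_symm {M : Type*} [AddCommGroup M]
    [Module (SymmetricAlgebra A L) M] [Module R M] [IsScalarTower R (SymmetricAlgebra A L) M]
    (d : A →ₗ[R] M) (δ : L →ₗ[R] M)
    (hd : ∀ a b, d (a * b) = algebraMap A (SymmetricAlgebra A L) a • d b
      + algebraMap A (SymmetricAlgebra A L) b • d a)
    (hδ : ∀ (a : A) (x : L), δ (a • x) = algebraMap A (SymmetricAlgebra A L) a • δ x
      + SymmetricAlgebra.ι A L x • d a) :
    ∃ D : Derivation R (SymmetricAlgebra A L) M,
      (∀ a, D (algebraMap A _ a) = d a) ∧ ∀ x, D (SymmetricAlgebra.ι A L x) = δ x := by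
  let : Module (SymmetricAlgebra A L)ᵐᵒᵖ M := Module.compHom M
    ((RingHom.id (SymmetricAlgebra A L)).fromOpposite fun x y => mul_comm _ _)
  have : IsCentralScalar (SymmetricAlgebra A L) M := ⟨fun _ _ => rfl⟩
  have d1 : d 1 = 0 := by
    have := hd 1 1
    simpa using this
  let φ : A →+* TrivSqZeroExt (SymmetricAlgebra A L) M :=
    { toFun := fun a => TrivSqZeroExt.inl (algebraMap A _ a) + TrivSqZeroExt.inr (d a)
      map_zero' := by ext <;> simp
      map_one' := by ext <;> simp [d1]
      map_add' := fun a b => by ext <;> simp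
      map_mul' := fun a b => by ext <;> simp [hd] }
  let g : L →+ TrivSqZeroExt (SymmetricAlgebra A L) M :=
    { toFun := fun x => TrivSqZeroExt.inl (SymmetricAlgebra.ι A L x) + TrivSqZeroExt.inr (δ x)
      map_zero' := by ext <;> simp
      map_add' := fun a b => by ext <;> simp }
  have hg : ∀ (a : A) (x : L), g (a • x) = φ a * g x := fun a x => by
    ext
    · simp [φ, g, Algebra.smul_def]
    · simp [φ, g, hδ, Algebra.smul_def]; rfl
  obtain ⟨Φ, hΦ, hΦ'⟩ : ∃ Φ : SymmetricAlgebra A L →+* TrivSqZeroExt (SymmetricAlgebra A L) M,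
      (∀ a, Φ (algebraMap A _ a) = φ a) ∧ ∀ x, Φ (SymmetricAlgebra.ι A L x) = g x :=
    ⟨symmLift φ g hg, symmLift_algebraMap φ g hg, symmLift_ι φ g hg⟩
  have hfst : ∀ u, (Φ u).fst = u := by
    intro u
    induction u using SymmetricAlgebra.induction with
    | algebraMap a => simp [hΦ, φ]
    | ι x => simp [hΦ', g]
    | mul u v hu hv => simp [hu, hv]
    | add u v hu hv => simp [hu, hv]
  have hR : ∀ (r : R), (Φ (algebraMap R _ r)).snd = 0 := by
    intro r
    rw [IsScalarTower.algebraMap_apply R A, hΦ]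
    simp [φ, Algebra.algebraMap_eq_smul_one (A := A) r, d1]
  let D0 : SymmetricAlgebra A L →ₗ[R] M :=
    { toFun := fun u => (Φ u).snd
      map_add' := fun u v => by simp
      map_smul' := fun r u => by
        simp [Algebra.smul_def r u, hfst, hR] }
  refine ⟨Derivation.mk' D0 fun u v => ?_, fun a => ?_, fun x => ?_⟩
  · simp [D0, hfst]
  · simp [D0, hΦ, φ]
  · simp [D0, hΦ', g]

theorem derivation_symm_ext {M : Type*} [AddCommGroup M]
    [Module (SymmetricAlgebra A L) M] [Module R M]
    {D D' : Derivation R (SymmetricAlgebra A L) M}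
    (h : ∀ a, D (algebraMap A _ a) = D' (algebraMap A _ a))
    (h' : ∀ x, D (SymmetricAlgebra.ι A L x) = D' (SymmetricAlgebra.ι A L x)) : D = D' := by
  ext u
  induction u using SymmetricAlgebra.induction with
  | algebraMap a => exact h a
  | ι x => exact h' x
  | mul u v hu hv => simp [hu, hv]
  | add u v hu hv => simp [hu, hv]

end Extend

section Tautological

variable (R A L : Type*) [CommRing R] [CommRing A] [Algebra R A] [LieRing L] [LieAlgebra R L]
  [Module A L] [LieRingModule L A] [LieRinehartRing A L] [LieRinehartAlgebra R A L]

theorem algebraMap_symm_smul {R A L : Type*} [CommRing R] [CommRing A] [Algebra R A]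
    [AddCommGroup L] [Module R L] [Module A L] [IsScalarTower R A L] (r : R) (a : A) :
    algebraMap A (SymmetricAlgebra A L) (r • a) = r • algebraMap A (SymmetricAlgebra A L) a := by
  rw [Algebra.smul_def, map_mul, ← IsScalarTower.algebraMap_apply, ← Algebra.smul_def]

theorem ι_symm_smul {R A L : Type*} [CommRing R] [CommRing A] [Algebra R A]
    [AddCommGroup L] [Module R L] [Module A L] [IsScalarTower R A L] (r : R) (x : L) :
    SymmetricAlgebra.ι A L (r • x) = r • SymmetricAlgebra.ι A L x :=
  (SymmetricAlgebra.ι A L).map_smul_of_tower r x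

/-- The derivation `{a, ·}` of the symmetric algebra, for `a` in the base ring. -/
theorem exists_hamiltonian_base (a : A) :
    ∃ D : Derivation R (SymmetricAlgebra A L) (SymmetricAlgebra A L),
      (∀ b, D (algebraMap A _ b) = 0) ∧
      ∀ x, D (SymmetricAlgebra.ι A L x) = - algebraMap A _ ⁅x, a⁆ := by
  refine exists_derivation_symm (R := R) (A := A) (L := L) 0
    { toFun := fun x => - algebraMap A (SymmetricAlgebra A L) ⁅x, a⁆
      map_add' := fun x y => by simp [add_comm]
      map_smul' := fun r x => by
        rw [smul_lie, algebraMap_symm_smul, RingHom.id_apply, smul_neg] }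
    (fun a b => by simp) (fun b x => by simp)

/-- The derivation `{x, ·}` of the symmetric algebra, for `x` in the Lie-Rinehart algebra. -/
theorem exists_hamiltonian_gen (x : L) :
    ∃ D : Derivation R (SymmetricAlgebra A L) (SymmetricAlgebra A L),
      (∀ b, D (algebraMap A _ b) = algebraMap A _ ⁅x, b⁆) ∧
      ∀ y, D (SymmetricAlgebra.ι A L y) = SymmetricAlgebra.ι A L ⁅x, y⁆ := by
  refine exists_derivation_symm (R := R) (A := A) (L := L)
    { toFun := fun b => algebraMap A (SymmetricAlgebra A L) ⁅x, b⁆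
      map_add' := fun x y => by simp
      map_smul' := fun r b => by
        rw [lie_smul, algebraMap_symm_smul, RingHom.id_apply] }
    { toFun := fun y => SymmetricAlgebra.ι A L ⁅x, y⁆
      map_add' := fun x y => by simp
      map_smul' := fun r y => by
        rw [lie_smul, ι_symm_smul, RingHom.id_apply] }
    (fun a b => ?_) (fun b y => ?_)
  · simp [mul_comm]
  · simp only [LinearMap.coe_mk, AddHom.coe_mk, LieRinehartRing.leibniz_smul_right, map_add,
      map_smul, Algebra.smul_def, Algebra.algebraMap_self_apply]
    rw [mul_comm (SymmetricAlgebra.ι A L y)]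

/-- `u ↦ {u, ·}` as a derivation with values in the derivations. -/
theorem exists_hamiltonian :
    ∃ Θ : Derivation R (SymmetricAlgebra A L)
        (Derivation R (SymmetricAlgebra A L) (SymmetricAlgebra A L)),
      (∀ a b, Θ (algebraMap A _ a) (algebraMap A _ b) = 0) ∧
      (∀ a x, Θ (algebraMap A _ a) (SymmetricAlgebra.ι A L x) = - algebraMap A _ ⁅x, a⁆) ∧
      (∀ x a, Θ (SymmetricAlgebra.ι A L x) (algebraMap A _ a) = algebraMap A _ ⁅x, a⁆) ∧
      (∀ x y, Θ (SymmetricAlgebra.ι A L x) (SymmetricAlgebra.ι A L y) =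
        SymmetricAlgebra.ι A L ⁅x, y⁆) := by
  choose d hd hd' using exists_hamiltonian_base R A L
  choose δ hδ hδ' using exists_hamiltonian_gen R A L
  obtain ⟨Θ, h, h'⟩ := exists_derivation_symm (R := R) (A := A) (L := L)
    { toFun := d
      map_add' := fun a b => derivation_symm_ext (by simp [hd]) (by simp [hd', add_comm])
      map_smul' := fun r a => derivation_symm_ext (by simp [hd]) (fun x => by
        rw [hd', lie_smul, algebraMap_symm_smul, RingHom.id_apply, Derivation.smul_apply, hd',
          smul_neg]) }
    { toFun := δ
      map_add' := fun x y => derivation_symm_ext (by simp [hδ]) (by simp [hδ'])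
      map_smul' := fun r x => derivation_symm_ext (fun a => by
        rw [hδ, smul_lie, algebraMap_symm_smul, RingHom.id_apply, Derivation.smul_apply, hδ])
        (fun y => by
        rw [hδ', smul_lie, ι_symm_smul, RingHom.id_apply, Derivation.smul_apply, hδ']) }
    (fun a b => derivation_symm_ext (by simp [hd]) (fun x => by
      simp [hd', Algebra.smul_def]; ring))
    (fun a x => derivation_symm_ext (by simp [hδ, hd, Algebra.smul_def]) (by
      intro y
      have : ⁅a • x, y⁆ = a • ⁅x, y⁆ - ⁅y, a⁆ • x := by
        rw [← lie_skew, LieRinehartRing.leibniz_smul_right, ← lie_skew x y]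
        simp only [smul_neg]; abel
      simp [hδ', hd', this, Algebra.smul_def]; ring))
  refine ⟨Θ, ?_, ?_, ?_, ?_⟩ <;> intros <;> simp [h, h', hd, hd', hδ, hδ']

theorem exists_tautological :
    ∃ P : PoissonBracket R (SymmetricAlgebra A L),
      (∀ a b, P.br (algebraMap A _ a) (algebraMap A _ b) = 0) ∧
      (∀ x a, P.br (SymmetricAlgebra.ι A L x) (algebraMap A _ a) = algebraMap A _ ⁅x, a⁆) ∧
      (∀ x y, P.br (SymmetricAlgebra.ι A L x) (SymmetricAlgebra.ι A L y) =
        SymmetricAlgebra.ι A L ⁅x, y⁆) := by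
  obtain ⟨Θ, h1, h2, h3, h4⟩ := exists_hamiltonian R A L
  have skew : ∀ u v, Θ u v = - Θ v u := by
    intro u v
    induction u using SymmetricAlgebra.induction with
    | algebraMap a =>
      induction v using SymmetricAlgebra.induction with
      | algebraMap b => simp [h1]
      | ι y => simp [h2, h3]
      | mul v w hv hw => simp [hv, hw]; ring
      | add v w hv hw => simp [hv, hw]; ring
    | ι x =>
      induction v using SymmetricAlgebra.induction with
      | algebraMap b => simp [h2, h3]
      | ι y => rw [h4, h4, ← map_neg, lie_skew]
      | mul v w hv hw => simp [hv, hw]; ring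
      | add v w hv hw => simp [hv, hw]; ring
    | mul u w hu hw => simp [hu, hw]; ring
    | add u w hu hw => simp [hu, hw]; ring
  have self : ∀ u, Θ u u = 0 := by
    intro u
    induction u using SymmetricAlgebra.induction with
    | algebraMap a => simp [h1]
    | ι x => simp [h4]
    | mul u v hu hv => simp [hu, hv, skew v u]; ring
    | add u v hu hv => simp [hu, hv, skew v u]
  have jac : ∀ u v, Θ (Θ u v) = ⁅Θ u, Θ v⁆ := by
    intro u v
    induction u using SymmetricAlgebra.induction with
    | algebraMap a =>
      induction v using SymmetricAlgebra.induction with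
      | algebraMap b =>
        apply derivation_symm_ext <;> intros <;>
          simp [Derivation.commutator_apply, h1, h2]
      | ι y =>
        apply derivation_symm_ext <;> intros <;>
          simp [Derivation.commutator_apply, h1, h2, h3, h4]
      | mul v w hv hw =>
        ext t
        simp [hv, hw, Derivation.commutator_apply]; ring
      | add v w hv hw => ext t; simp [hv, hw, Derivation.commutator_apply]; ring
    | ι x =>
      induction v using SymmetricAlgebra.induction with
      | algebraMap b =>
        apply derivation_symm_ext <;> intros
        · simp [Derivation.commutator_apply, h1, h3]
        · simp [Derivation.commutator_apply, h2, h3, h4]; abel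
      | ι y =>
        apply derivation_symm_ext <;> intros <;> simp [Derivation.commutator_apply, h3, h4]
      | mul v w hv hw =>
        ext t
        simp [hv, hw, Derivation.commutator_apply]; ring
      | add v w hv hw => ext t; simp [hv, hw, Derivation.commutator_apply]; ring
    | mul u w hu hw =>
      ext t
      simp [hu, hw, Derivation.commutator_apply, skew v]; ring
    | add u w hu hw => ext t; simp [hu, hw, Derivation.commutator_apply]; ring
  let B : SymmetricAlgebra A L →ₗ[R] SymmetricAlgebra A L →ₗ[R] SymmetricAlgebra A L :=
    LinearMap.mk₂ R (fun u v => Θ u v) (by simp) (by simp) (by simp) (by simp)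
  refine ⟨⟨B, self, fun u v w => ?_, fun u v w => ?_⟩, h1, h3, h4⟩
  · simp [B, jac, Derivation.commutator_apply]
  · simp [B]; ring

/-- The **tautological Poisson bracket** on the symmetric `A`-algebra of a Lie-Rinehart algebra
`(A, L)`: the unique Poisson bracket with `{x, y} = [x, y]`, `{x, a} = x(a)` and `{a, b} = 0` for
`x, y ∈ L` and `a, b ∈ A`; see `tautological_unique`. -/
noncomputable def tautological : PoissonBracket R (SymmetricAlgebra A L) :=
  Classical.choose (exists_tautological R A L)

theorem tautological_algebraMap_algebraMap (a b : A) :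
    (tautological R A L).br (algebraMap A _ a) (algebraMap A _ b) = 0 :=
  (Classical.choose_spec (exists_tautological R A L)).1 a b

theorem tautological_ι_algebraMap (x : L) (a : A) :
    (tautological R A L).br (SymmetricAlgebra.ι A L x) (algebraMap A _ a) =
      algebraMap A _ ⁅x, a⁆ :=
  (Classical.choose_spec (exists_tautological R A L)).2.1 x a

theorem tautological_ι_ι (x y : L) :
    (tautological R A L).br (SymmetricAlgebra.ι A L x) (SymmetricAlgebra.ι A L y) =
      SymmetricAlgebra.ι A L ⁅x, y⁆ :=
  (Classical.choose_spec (exists_tautological R A L)).2.2 x y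

theorem tautological_unique (P : PoissonBracket R (SymmetricAlgebra A L))
    (h1 : ∀ a b, P.br (algebraMap A _ a) (algebraMap A _ b) = 0)
    (h2 : ∀ x a, P.br (SymmetricAlgebra.ι A L x) (algebraMap A _ a) = algebraMap A _ ⁅x, a⁆)
    (h3 : ∀ x y, P.br (SymmetricAlgebra.ι A L x) (SymmetricAlgebra.ι A L y) =
      SymmetricAlgebra.ι A L ⁅x, y⁆) :
    P = tautological R A L := by
  have skew : ∀ (P : PoissonBracket R (SymmetricAlgebra A L)) u v, P.br u v = - P.br v u := by
    intro P u v
    have := P.br_self (u + v)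
    simp only [map_add, LinearMap.add_apply, P.br_self] at this
    rw [eq_neg_iff_add_eq_zero]
    linear_combination this
  have key : P.br = (tautological R A L).br := by
    ext u v
    induction u using SymmetricAlgebra.induction with
    | algebraMap a =>
      induction v using SymmetricAlgebra.induction with
      | algebraMap b => rw [h1, tautological_algebraMap_algebraMap]
      | ι y => rw [skew, h2, skew, tautological_ι_algebraMap]
      | mul v w hv hw => rw [P.leibniz, PoissonBracket.leibniz, hv, hw]
      | add v w hv hw => rw [map_add, map_add, hv, hw]
    | ι x =>
      induction v using SymmetricAlgebra.induction with
      | algebraMap b => rw [h2, tautological_ι_algebraMap]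
      | ι y => rw [h3, tautological_ι_ι]
      | mul v w hv hw => rw [P.leibniz, PoissonBracket.leibniz, hv, hw]
      | add v w hv hw => rw [map_add, map_add, hv, hw]
    | mul u w hu hw =>
      rw [skew, skew (tautological R A L), P.leibniz, PoissonBracket.leibniz, skew P, hu,
        skew _ u, skew P, hw, skew _ w]
      simp
    | add u w hu hw => rw [map_add, map_add, LinearMap.add_apply, LinearMap.add_apply, hu, hw]
  cases P
  simp only at key
  subst key
  rfl

end Tautological

section Extension

variable {R A L M : Type*} [CommRing R] [CommRing A] [Algebra R A]
  [LieRing L] [LieAlgebra R L] [Module A L] [LieRingModule L A] [LieRinehartRing A L]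
  [LieRinehartAlgebra R A L]
  [LieRing M] [LieAlgebra R M] [Module A M] [LieRingModule M A] [LieRinehartRing A M]
  [LieRinehartAlgebra R A M]

/-- The kernel of a morphism of Lie-Rinehart algebras over the fixed algebra `A`. -/
def Hom.kernel (p : Hom (AlgHom.id R A) L M) : LieRinehartSubalgebra A L where
  carrier := {x | p x = 0}
  zero_mem' := p.toLieHom.map_zero
  add_mem' {x y} hx hy := by
    change p.toLieHom (x + y) = 0
    rw [map_add, show p.toLieHom x = 0 from hx, show p.toLieHom y = 0 from hy, add_zero]
  smul_mem' a x hx := by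
    change p (a • x) = 0
    rw [p.map_smul_apply, show p x = 0 from hx, smul_zero]
  lie_mem' {x y} hx hy := by
    change p.toLieHom ⁅x, y⁆ = 0
    rw [LieHom.map_lie, show p.toLieHom x = 0 from hx, zero_lie]

/-- The image of a morphism of Lie-Rinehart algebras over the fixed algebra `A`. -/
def Hom.image (p : Hom (AlgHom.id R A) L M) : LieRinehartSubalgebra A M where
  carrier := Set.range p
  zero_mem' := ⟨0, p.toLieHom.map_zero⟩
  add_mem' := by
    rintro _ _ ⟨x, rfl⟩ ⟨y, rfl⟩
    exact ⟨x + y, p.toLieHom.map_add x y⟩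
  smul_mem' := by
    rintro a _ ⟨x, rfl⟩
    exact ⟨a • x, p.map_smul_apply a x⟩
  lie_mem' := by
    rintro _ _ ⟨x, rfl⟩ ⟨y, rfl⟩
    exact ⟨⁅x, y⁆, p.toLieHom.map_lie x y⟩

/-- The projection onto the image. -/
def Hom.toImage (p : Hom (AlgHom.id R A) L M) : Hom (AlgHom.id R A) L p.image where
  toFun x := ⟨p x, x, rfl⟩
  map_add' x y := Subtype.ext (p.toLieHom.map_add x y)
  map_smul' r x := Subtype.ext (p.toLieHom.map_smul r x)
  map_lie' {x y} := Subtype.ext (p.toLieHom.map_lie x y)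
  map_smul_apply' a x := Subtype.ext (p.map_smul_apply a x)
  apply_lie' a x := p.apply_lie a x

/-- A connection for the extension `0 → ker p → L → M → 0` of Lie-Rinehart algebras: a section of
the projection `p` in the category of `A`-modules. -/
structure Connection (p : Hom (AlgHom.id R A) L M) where
  toLinearMap : M →ₗ[A] L
  section_apply : ∀ x, p (toLinearMap x) = x

instance (p : Hom (AlgHom.id R A) L M) : CoeFun (Connection p) (fun _ => M → L) :=
  ⟨fun ω => ω.toLinearMap⟩

/-- The action of `x` on `A` is that of its lift under a connection. -/
theorem Connection.lie_apply {R A L M : Type*} [CommRing R] [CommRing A] [Algebra R A]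
    [LieRing L] [LieAlgebra R L] [Module A L] [LieRingModule L A]
    [LieRing M] [LieAlgebra R M] [Module A M] [LieRingModule M A]
    {p : Hom (AlgHom.id R A) L M} (ω : Connection p) (x : M) (a : A) :
    ⁅ω x, a⁆ = ⁅x, a⁆ := by
  have := p.apply_lie a (ω x)
  rw [ω.section_apply] at this
  exact this

theorem lie_smul_left (x y : L) (a : A) : ⁅a • x, y⁆ = a • ⁅x, y⁆ - ⁅y, a⁆ • x := by
  rw [← lie_skew, LieRinehartRing.leibniz_smul_right, ← lie_skew x y]
  simp only [smul_neg]
  abel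

/-- The curvature `Ω(x, y) = [ω x, ω y] - ω [x, y]` of a connection, an `A`-bilinear map with
values in the kernel of the projection. -/
def Connection.curvature {p : Hom (AlgHom.id R A) L M} (ω : Connection p) :
    M →ₗ[A] M →ₗ[A] p.kernel :=
  LinearMap.mk₂ A (fun x y => ⟨⁅ω x, ω y⁆ - ω ⁅x, y⁆, by
      change p.toLieHom (⁅ω x, ω y⁆ - ω ⁅x, y⁆) = 0
      have h := ω.section_apply
      rw [map_sub, LieHom.map_lie, h, h, h, sub_self]⟩)
    (fun x x' y => Subtype.ext (by
      change _ = (⁅ω x, ω y⁆ - ω ⁅x, y⁆) + (⁅ω x', ω y⁆ - ω ⁅x', y⁆)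
      simp only [map_add, add_lie]
      abel))
    (fun a x y => Subtype.ext (by
      change _ = a • (⁅ω x, ω y⁆ - ω ⁅x, y⁆)
      simp only [map_smul, lie_smul_left, map_sub, ω.lie_apply, smul_sub]
      abel))
    (fun x y y' => Subtype.ext (by
      change _ = (⁅ω x, ω y⁆ - ω ⁅x, y⁆) + (⁅ω x, ω y'⁆ - ω ⁅x, y'⁆)
      simp only [map_add, lie_add]
      abel))
    (fun a x y => Subtype.ext (by
      change _ = a • (⁅ω x, ω y⁆ - ω ⁅x, y⁆)
      simp only [map_smul, LieRinehartRing.leibniz_smul_right, map_add, ω.lie_apply, smul_sub]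
      abel))

theorem Connection.curvature_apply {p : Hom (AlgHom.id R A) L M} (ω : Connection p) (x y : M) :
    (ω.curvature x y : L) = ⁅ω x, ω y⁆ - ω ⁅x, y⁆ := rfl

theorem Connection.curvature_self {p : Hom (AlgHom.id R A) L M} (ω : Connection p) (x : M) :
    ω.curvature x x = 0 :=
  Subtype.ext (by rw [ω.curvature_apply]; simp)

/-- The identities describing a Poisson bracket on the symmetric algebra of `L` in terms of the
extension `0 → L' → L → L'' → 0` and of a connection `ω` with curvature `Ω`. Elements of `L''` are
regarded as elements of `L` through `ω`; the Leibniz rule is part of `PoissonBracket`. -/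
structure Connection.Describes {p : Hom (AlgHom.id R A) L M} (ω : Connection p)
    (P : PoissonBracket R (SymmetricAlgebra A L)) : Prop where
  /-- `{x', y'} = [x', y']` on `L'`. -/
  ker_ker : ∀ x y : p.kernel,
    P.br (SymmetricAlgebra.ι A L x) (SymmetricAlgebra.ι A L y) =
      SymmetricAlgebra.ι A L (⁅x, y⁆ : p.kernel)
  /-- `{x'', y''} = [x'', y''] + Ω(x'', y'')` on `L''`. -/
  base_base : ∀ x y : M,
    P.br (SymmetricAlgebra.ι A L (ω x)) (SymmetricAlgebra.ι A L (ω y)) =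
      SymmetricAlgebra.ι A L (ω ⁅x, y⁆) + SymmetricAlgebra.ι A L (ω.curvature x y)
  /-- `{x'', y'} = [ω(x''), y']`, the covariant derivative of `y'` along `x''`. -/
  base_ker : ∀ (x : M) (y : p.kernel),
    P.br (SymmetricAlgebra.ι A L (ω x)) (SymmetricAlgebra.ι A L y) =
      SymmetricAlgebra.ι A L ⁅ω x, (y : L)⁆
  /-- `{x'', a} = x''(a)`. -/
  base_fun : ∀ (x : M) (a : A),
    P.br (SymmetricAlgebra.ι A L (ω x)) (algebraMap A _ a) = algebraMap A _ ⁅x, a⁆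
  /-- `{x', a} = 0`. -/
  ker_fun : ∀ (x : p.kernel) (a : A),
    P.br (SymmetricAlgebra.ι A L x) (algebraMap A _ a) = 0
  /-- `{a, b} = 0`. -/
  fun_fun : ∀ a b : A,
    P.br (algebraMap A _ a) (algebraMap A (SymmetricAlgebra A L) b) = 0

end Extension

end LieRinehartAlgebra

/-! ### Smooth functions, sections and vector fields -/

namespace LieAlgebroidTheory

open Bundle Manifold VectorField
open scoped ContDiff

section Sections

variable {E : Type*} [NormedAddCommGroup E] [NormedSpace ℝ E]
  {N : Type*} [TopologicalSpace N] [ChartedSpace E N]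

variable (E N) in
/-- The algebra `A` of smooth real functions on `N`. -/
abbrev SmoothFunctions : Type _ := C^∞⟮𝓘(ℝ, E), N; ℝ⟯

variable {F : Type*} [NormedAddCommGroup F] [NormedSpace ℝ F]
  {V : N → Type*} [TopologicalSpace (TotalSpace F V)] [∀ x, TopologicalSpace (V x)]
  [FiberBundle F V] [∀ x, AddCommGroup (V x)] [∀ x, Module ℝ (V x)] [VectorBundle ℝ F V]

/-- Smooth sections form a module over the smooth functions. -/
noncomputable instance : Module (SmoothFunctions E N) (Cₛ^∞⟮𝓘(ℝ, E); F, V⟯) where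
  smul f s := ⟨fun x => f x • s x, f.contMDiff.smul_section s.contMDiff⟩
  one_smul s := ContMDiffSection.ext fun x => one_smul ℝ (s x)
  mul_smul f g s := ContMDiffSection.ext fun x => mul_smul (f x) (g x) (s x)
  smul_zero f := ContMDiffSection.ext fun x => smul_zero (f x)
  smul_add f s t := ContMDiffSection.ext fun x => smul_add (f x) (s x) (t x)
  add_smul f g s := ContMDiffSection.ext fun x => add_smul (f x) (g x) (s x)
  zero_smul s := ContMDiffSection.ext fun x => zero_smul ℝ (s x)

theorem smul_section_apply (f : SmoothFunctions E N) (s : Cₛ^∞⟮𝓘(ℝ, E); F, V⟯) (x : N) :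
    (f • s) x = f x • s x := rfl

instance : IsScalarTower ℝ (SmoothFunctions E N) (Cₛ^∞⟮𝓘(ℝ, E); F, V⟯) where
  smul_assoc r f s := ContMDiffSection.ext fun x => mul_smul r (f x) (s x)

end Sections

section VectorFields

variable {E : Type*} [NormedAddCommGroup E] [NormedSpace ℝ E]
  {N : Type*} [TopologicalSpace N] [ChartedSpace E N] [IsManifold 𝓘(ℝ, E) ∞ N]

variable (E N) in
/-- The smooth vector fields on `N`. -/
abbrev VectorFields : Type _ := Cₛ^∞⟮𝓘(ℝ, E); E, (TangentSpace 𝓘(ℝ, E) : N → Type _)⟯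

/-- The derivative `x ↦ df_x(X_x)` of a smooth function along a smooth vector field. -/
noncomputable def VectorFields.deriv (X : VectorFields E N) (f : SmoothFunctions E N) :
    SmoothFunctions E N :=
  ⟨fun x => mvfderiv 𝓘(ℝ, E) f x (X x), by
    have h := (f.contMDiff.contMDiff_tangentMap (m := ∞) (by simp)).comp X.contMDiff
    exact (contMDiff_snd_tangentBundle_modelSpace ℝ 𝓘(ℝ, ℝ)).comp h⟩

theorem VectorFields.deriv_apply (X : VectorFields E N) (f : SmoothFunctions E N) (x : N) :
    X.deriv f x = mvfderiv 𝓘(ℝ, E) f x (X x) := rfl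

theorem isManifold_minSmoothness (n : ℕ) : IsManifold 𝓘(ℝ, E) (minSmoothness ℝ n) N := by
  rw [minSmoothness_of_isRCLikeNormedField]
  exact IsManifold.of_le (n := ∞) (WithTop.coe_le_coe.2 le_top)

theorem VectorFields.deriv_add (X : VectorFields E N) (f g : SmoothFunctions E N) :
    X.deriv (f + g) = X.deriv f + X.deriv g := by
  ext x
  have h (f : SmoothFunctions E N) := f.contMDiff.mdifferentiable (by simp) x
  exact congr($(mvfderiv_add (h f) (h g)) (X x))

theorem VectorFields.deriv_mul (X : VectorFields E N) (f g : SmoothFunctions E N) :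
    X.deriv (f * g) = f * X.deriv g + X.deriv f * g := by
  ext x
  have h (f : SmoothFunctions E N) := f.contMDiff.mdifferentiable (by simp) x
  rw [mul_comm (X.deriv f)]
  exact congr($(mvfderiv_mul (h f) (h g)) (X x))

theorem VectorFields.add_deriv (X Y : VectorFields E N) (f : SmoothFunctions E N) :
    (X + Y).deriv f = X.deriv f + Y.deriv f := by
  ext x
  exact (mvfderiv 𝓘(ℝ, E) f x).map_add _ _

theorem VectorFields.smul_deriv (f : SmoothFunctions E N) (X : VectorFields E N)
    (g : SmoothFunctions E N) : (f • X).deriv g = f * X.deriv g := by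
  ext x
  exact (mvfderiv 𝓘(ℝ, E) g x).map_smul _ _

theorem VectorFields.deriv_const_smul (X : VectorFields E N) (r : ℝ) (f : SmoothFunctions E N) :
    X.deriv (r • f) = r • X.deriv f := by
  have h1 : X.deriv (algebraMap ℝ (SmoothFunctions E N) r) = 0 := by
    ext x
    exact congr($(mvfderiv_const (I := 𝓘(ℝ, E)) r (x := x)) (X x))
  rw [Algebra.smul_def, VectorFields.deriv_mul, h1, zero_mul, add_zero, ← Algebra.smul_def]

variable [FiniteDimensional ℝ E]

theorem VectorFields.contMDiff_mlieBracket (X Y : VectorFields E N) :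
    ContMDiff 𝓘(ℝ, E) (𝓘(ℝ, E).prod 𝓘(ℝ, E)) ∞
      (fun x => TotalSpace.mk' E x (mlieBracket 𝓘(ℝ, E) X Y x)) := by
  have := FiniteDimensional.complete ℝ E
  have : IsManifold 𝓘(ℝ, E) (((⊤ : ℕ∞) : WithTop ℕ∞) + 1) N := by
    simpa using! ‹IsManifold 𝓘(ℝ, E) ∞ N›
  have : IsManifold 𝓘(ℝ, E) (minSmoothness ℝ 2) N := isManifold_minSmoothness 2
  have : IsManifold 𝓘(ℝ, E) (minSmoothness ℝ 3) N := isManifold_minSmoothness 3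
  exact ContDiff.mlieBracket_vectorField (n := ⊤) (m := ⊤) X.contMDiff Y.contMDiff
    (by rw [minSmoothness_of_isRCLikeNormedField]; simp)

/-- The Lie bracket of smooth vector fields. -/
noncomputable instance : Bracket (VectorFields E N) (VectorFields E N) where
  bracket X Y := ⟨mlieBracket 𝓘(ℝ, E) X Y, X.contMDiff_mlieBracket Y⟩

theorem VectorFields.lie_apply (X Y : VectorFields E N) (x : N) :
    ⁅X, Y⁆ x = mlieBracket 𝓘(ℝ, E) X Y x := rfl

theorem VectorFields.lie_smul_fun (X Y : VectorFields E N) (f : SmoothFunctions E N) :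
    ⁅X, f • Y⁆ = f • ⁅X, Y⁆ + X.deriv f • Y := by
  ext x
  have := FiniteDimensional.complete ℝ E
  have : IsManifold 𝓘(ℝ, E) 2 N := IsManifold.of_le (n := ∞) (WithTop.coe_le_coe.2 le_top)
  have := mlieBracket_smul_right (I := 𝓘(ℝ, E)) (V := X) (W := Y) (x := x) (f := f)
    (f.contMDiff.mdifferentiable (by simp) x) (Y.mdifferentiable x)
  rw [add_comm]
  exact this

noncomputable instance : LieRing (VectorFields E N) where
  add_lie X Y Z := by
    ext x
    have := FiniteDimensional.complete ℝ E
    have : IsManifold 𝓘(ℝ, E) 2 N := IsManifold.of_le (n := ∞) (WithTop.coe_le_coe.2 le_top)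
    exact mlieBracket_add_left (X.mdifferentiable x) (Y.mdifferentiable x)
  lie_add X Y Z := by
    ext x
    have := FiniteDimensional.complete ℝ E
    have : IsManifold 𝓘(ℝ, E) 2 N := IsManifold.of_le (n := ∞) (WithTop.coe_le_coe.2 le_top)
    exact mlieBracket_add_right (Y.mdifferentiable x) (Z.mdifferentiable x)
  lie_self X := by
    ext x
    change mlieBracket 𝓘(ℝ, E) X X x = 0
    simp
  leibniz_lie X Y Z := by
    ext x
    have := FiniteDimensional.complete ℝ E
    have : IsManifold 𝓘(ℝ, E) (minSmoothness ℝ 3) N := isManifold_minSmoothness 3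
    have h (X : VectorFields E N) := (X.contMDiff.of_le
      (show minSmoothness ℝ 2 ≤ ∞ by
        rw [minSmoothness_of_isRCLikeNormedField]; exact WithTop.coe_le_coe.2 le_top)) x
    exact leibniz_identity_mlieBracket_apply (h X) (h Y) (h Z)

noncomputable instance : LieAlgebra ℝ (VectorFields E N) where
  lie_smul r X Y := by
    ext x
    have := FiniteDimensional.complete ℝ E
    have : IsManifold 𝓘(ℝ, E) 2 N := IsManifold.of_le (n := ∞) (WithTop.coe_le_coe.2 le_top)
    exact mlieBracket_const_smul_right (Y.mdifferentiable x)

/-- The Lie bracket acts on functions as the commutator. -/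
theorem VectorFields.lie_deriv (X Y : VectorFields E N) (f : SmoothFunctions E N) :
    ⁅X, Y⁆.deriv f = X.deriv (Y.deriv f) - Y.deriv (X.deriv f) := by
  have key (Z : VectorFields E N) :
      (X.deriv (Y.deriv f) - Y.deriv (X.deriv f) - ⁅X, Y⁆.deriv f) • Z = 0 := by
    have h := leibniz_lie X Y (f • Z)
    simp only [VectorFields.lie_smul_fun, lie_add, leibniz_lie X Y Z, smul_add] at h
    rw [sub_smul, sub_smul]
    have h' := sub_eq_zero.mpr h
    rw [← h']
    abel
  ext x
  have kx (Z : VectorFields E N) (hZ : Z x ≠ 0) :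
      (X.deriv (Y.deriv f) - Y.deriv (X.deriv f) - ⁅X, Y⁆.deriv f) x = 0 := by
    have := congr($(key Z) x)
    rw [smul_section_apply] at this
    exact (smul_eq_zero.mp this).resolve_right hZ
  by_cases hX : X x = 0
  · by_cases hY : Y x = 0
    · have : ⁅X, Y⁆ x = 0 := by
        rw [VectorFields.lie_apply, ← mlieBracketWithin_univ]
        exact mlieBracketWithin_eq_zero_of_eq_zero hX hY
      change mvfderiv 𝓘(ℝ, E) f x (⁅X, Y⁆ x) =
        mvfderiv 𝓘(ℝ, E) (Y.deriv f) x (X x) - mvfderiv 𝓘(ℝ, E) (X.deriv f) x (Y x)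
      rw [this, hX, hY]
      simp
    · exact (sub_eq_zero.mp (kx Y hY)).symm
  · exact (sub_eq_zero.mp (kx X hX)).symm

/-- Vector fields act on functions by differentiation. -/
noncomputable instance : LieRingModule (VectorFields E N) (SmoothFunctions E N) where
  bracket X f := X.deriv f
  add_lie := VectorFields.add_deriv
  lie_add := VectorFields.deriv_add
  leibniz_lie X Y f := by
    change X.deriv (Y.deriv f) = ⁅X, Y⁆.deriv f + Y.deriv (X.deriv f)
    rw [VectorFields.lie_deriv]
    abel

theorem VectorFields.lie_fun (X : VectorFields E N) (f : SmoothFunctions E N) :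
    ⁅X, f⁆ = X.deriv f := rfl

noncomputable instance : LieRinehartRing (SmoothFunctions E N) (VectorFields E N) where
  lie_smul_eq_mul' f g X := X.smul_deriv f g
  leibniz_mul_right' X f g := X.deriv_mul f g
  leibniz_smul_right' X Y f := X.lie_smul_fun Y f

/-- Smooth functions and smooth vector fields form a Lie-Rinehart algebra. -/
noncomputable instance : LieRinehartAlgebra ℝ (SmoothFunctions E N) (VectorFields E N) where
  smul_lie r X f := by
    ext x
    exact (mvfderiv 𝓘(ℝ, E) f x).map_smul _ _
  lie_smul r X f := X.deriv_const_smul r f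

end VectorFields

section Foliation

variable {E : Type*} [NormedAddCommGroup E] [NormedSpace ℝ E]
  {N : Type*} [TopologicalSpace N] [ChartedSpace E N] [IsManifold 𝓘(ℝ, E) ∞ N]

/-- A family `D` of tangent subspaces is (the tangent distribution of) a regular foliation: it is a
smooth subbundle of the tangent bundle, that is, it has constant rank and every vector in `D`
extends to a smooth vector field with values in `D`, and it is involutive. -/
structure IsFoliation [FiniteDimensional ℝ E]
    (D : ∀ x : N, Submodule ℝ (TangentSpace 𝓘(ℝ, E) x)) : Prop where
  rank : ∃ r : ℕ, ∀ x, Module.finrank ℝ (D x) = r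
  smooth : ∀ x, ∀ v ∈ D x, ∃ X : VectorFields E N, (∀ y, X y ∈ D y) ∧ X x = v
  involutive : ∀ X Y : VectorFields E N, (∀ y, X y ∈ D y) → (∀ y, Y y ∈ D y) →
    ∀ y, ⁅X, Y⁆ y ∈ D y

/-- Two points are in the same leaf of `D` if they can be joined by finitely many `C¹` curves
everywhere tangent to `D`. -/
def SameLeaf (D : ∀ x : N, Submodule ℝ (TangentSpace 𝓘(ℝ, E) x)) : N → N → Prop :=
  Relation.EqvGen fun x y => ∃ γ : ℝ → N, ContMDiff 𝓘(ℝ, ℝ) 𝓘(ℝ, E) 1 γ ∧ γ 0 = x ∧ γ 1 = y ∧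
    ∀ t, mfderiv 𝓘(ℝ, ℝ) 𝓘(ℝ, E) γ t (1 : ℝ) ∈ D (γ t)

/-- The algebra of smooth functions which are constant on the leaves of `D`. -/
def leafConstants (D : ∀ x : N, Submodule ℝ (TangentSpace 𝓘(ℝ, E) x)) :
    Subalgebra ℝ (SmoothFunctions E N) where
  carrier := {f | ∀ x y, SameLeaf D x y → f x = f y}
  mul_mem' hf hg x y h := congr_arg₂ (· * ·) (hf x y h) (hg x y h)
  add_mem' hf hg x y h := congr_arg₂ (· + ·) (hf x y h) (hg x y h)
  algebraMap_mem' _ _ _ _ := rfl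

end Foliation

section LieAlgebroids

variable (E : Type*) [NormedAddCommGroup E] [NormedSpace ℝ E] [FiniteDimensional ℝ E]
  {N : Type*} [TopologicalSpace N] [ChartedSpace E N] [IsManifold 𝓘(ℝ, E) ∞ N]
  (F : Type*) [NormedAddCommGroup F] [NormedSpace ℝ F]
  (V : N → Type*) [TopologicalSpace (TotalSpace F V)] [∀ x, TopologicalSpace (V x)]
  [FiberBundle F V] [∀ x, AddCommGroup (V x)] [∀ x, Module ℝ (V x)] [VectorBundle ℝ F V]

/-- A smooth morphism of vector bundles over `N` from `V` to the tangent bundle. -/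
structure Anchor where
  toFun : ∀ x : N, V x →ₗ[ℝ] TangentSpace 𝓘(ℝ, E) x
  contMDiff : ContMDiff (𝓘(ℝ, E).prod 𝓘(ℝ, F)) (𝓘(ℝ, E).prod 𝓘(ℝ, E)) ∞
    fun v : TotalSpace F V => TotalSpace.mk' E (E := (TangentSpace 𝓘(ℝ, E) : N → Type _))
      v.1 (toFun v.1 v.2)

variable {E F V}

/-- The map on smooth sections induced by an anchor. -/
noncomputable def Anchor.onSections (ρ : Anchor E F V) :
    Cₛ^∞⟮𝓘(ℝ, E); F, V⟯ →ₗ[SmoothFunctions E N] VectorFields E N where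
  toFun s := ⟨fun x => ρ.toFun x (s x), ρ.contMDiff.comp s.contMDiff⟩
  map_add' s t := ContMDiffSection.ext fun x => (ρ.toFun x).map_add (s x) (t x)
  map_smul' f s := ContMDiffSection.ext fun x => (ρ.toFun x).map_smul (f x) (s x)

variable (E F V)

/-- A Lie algebroid structure on the smooth vector bundle `V` over `N`: an anchor and a Lie bracket
on the smooth sections, such that the anchor is compatible with brackets and the Leibniz rule
`[s, f t] = f [s, t] + (ρ(s) f) t` holds. -/
structure LieAlgebroid where
  anchor : Anchor E F V
  bracket : Cₛ^∞⟮𝓘(ℝ, E); F, V⟯ → Cₛ^∞⟮𝓘(ℝ, E); F, V⟯ → Cₛ^∞⟮𝓘(ℝ, E); F, V⟯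
  add_bracket : ∀ s s' t, bracket (s + s') t = bracket s t + bracket s' t
  bracket_add : ∀ s t t', bracket s (t + t') = bracket s t + bracket s t'
  bracket_self : ∀ s, bracket s s = 0
  jacobi : ∀ s t u, bracket s (bracket t u) = bracket (bracket s t) u + bracket t (bracket s u)
  bracket_smul : ∀ (s : Cₛ^∞⟮𝓘(ℝ, E); F, V⟯) (f : SmoothFunctions E N)
    (t : Cₛ^∞⟮𝓘(ℝ, E); F, V⟯),
    bracket s (f • t) = f • bracket s t + (anchor.onSections s).deriv f • t
  anchor_bracket : ∀ s t,
    anchor.onSections (bracket s t) = ⁅anchor.onSections s, anchor.onSections t⁆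

variable {E F V}

namespace LieAlgebroid

variable (𝓛 : LieAlgebroid E F V)

/-- The module `L` of smooth sections of a Lie algebroid. -/
def Sections (_ : LieAlgebroid E F V) : Type _ := Cₛ^∞⟮𝓘(ℝ, E); F, V⟯

noncomputable instance : AddCommGroup 𝓛.Sections :=
  inferInstanceAs (AddCommGroup (Cₛ^∞⟮𝓘(ℝ, E); F, V⟯))

noncomputable instance : Module ℝ 𝓛.Sections :=
  inferInstanceAs (Module ℝ (Cₛ^∞⟮𝓘(ℝ, E); F, V⟯))

noncomputable instance : Module (SmoothFunctions E N) 𝓛.Sections :=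
  inferInstanceAs (Module (SmoothFunctions E N) (Cₛ^∞⟮𝓘(ℝ, E); F, V⟯))

instance : IsScalarTower ℝ (SmoothFunctions E N) 𝓛.Sections :=
  inferInstanceAs (IsScalarTower ℝ (SmoothFunctions E N) (Cₛ^∞⟮𝓘(ℝ, E); F, V⟯))

/-- Sections, regarded as smooth sections of the underlying vector bundle. -/
noncomputable def sectionsEquiv :
    𝓛.Sections ≃ₗ[SmoothFunctions E N] Cₛ^∞⟮𝓘(ℝ, E); F, V⟯ :=
  LinearEquiv.refl _ (Cₛ^∞⟮𝓘(ℝ, E); F, V⟯)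

/-- The value of a section at a point. -/
noncomputable def value (s : 𝓛.Sections) (x : N) : V x := 𝓛.sectionsEquiv s x

/-- The map `L → Vect(N)` induced by the anchor. -/
noncomputable def anchorMap : 𝓛.Sections →ₗ[SmoothFunctions E N] VectorFields E N :=
  𝓛.anchor.onSections ∘ₗ 𝓛.sectionsEquiv.toLinearMap

noncomputable instance : LieRing 𝓛.Sections where
  bracket := 𝓛.bracket
  add_lie := 𝓛.add_bracket
  lie_add := 𝓛.bracket_add
  lie_self := 𝓛.bracket_self
  leibniz_lie := 𝓛.jacobi

theorem anchorMap_lie (s t : 𝓛.Sections) :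
    𝓛.anchorMap ⁅s, t⁆ = ⁅𝓛.anchorMap s, 𝓛.anchorMap t⁆ := 𝓛.anchor_bracket s t

theorem anchorMap_apply (s : 𝓛.Sections) (x : N) :
    𝓛.anchorMap s x = 𝓛.anchor.toFun x (𝓛.value s x) := rfl

/-- Sections act on functions through the anchor. -/
noncomputable instance : LieRingModule 𝓛.Sections (SmoothFunctions E N) where
  bracket s f := (𝓛.anchorMap s).deriv f
  add_lie s t f := by
    change (𝓛.anchorMap (s + t)).deriv f = _
    rw [map_add, VectorFields.add_deriv]
  lie_add s f g := VectorFields.deriv_add _ f g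
  leibniz_lie s t f := by
    change (𝓛.anchorMap s).deriv ((𝓛.anchorMap t).deriv f) =
      (𝓛.anchorMap ⁅s, t⁆).deriv f + (𝓛.anchorMap t).deriv ((𝓛.anchorMap s).deriv f)
    rw [𝓛.anchorMap_lie, VectorFields.lie_deriv]
    abel

theorem lie_fun (s : 𝓛.Sections) (f : SmoothFunctions E N) : ⁅s, f⁆ = (𝓛.anchorMap s).deriv f :=
  rfl

noncomputable instance : LieRinehartRing (SmoothFunctions E N) 𝓛.Sections where
  lie_smul_eq_mul' f g s := by
    rw [lie_fun, map_smul, VectorFields.smul_deriv, lie_fun]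
  leibniz_mul_right' s f g := VectorFields.deriv_mul _ f g
  leibniz_smul_right' s t f := 𝓛.bracket_smul s f t

noncomputable instance : LieAlgebra ℝ 𝓛.Sections where
  lie_smul r s t := by
    have h1 : ⁅s, algebraMap ℝ (SmoothFunctions E N) r⁆ = 0 := by
      rw [lie_fun]
      ext x
      exact congr($(mvfderiv_const (I := 𝓘(ℝ, E)) r (x := x)) (𝓛.anchorMap s x))
    rw [← algebraMap_smul (SmoothFunctions E N) r t, LieRinehartRing.leibniz_smul_right, h1,
      zero_smul, add_zero, algebraMap_smul]

/-- The pair `(A, L)` of a Lie algebroid is a Lie-Rinehart algebra. -/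
noncomputable instance : LieRinehartAlgebra ℝ (SmoothFunctions E N) 𝓛.Sections where
  smul_lie r s f := by
    rw [lie_fun, ← algebraMap_smul (SmoothFunctions E N) r s, map_smul, VectorFields.smul_deriv,
      ← Algebra.smul_def, lie_fun]
  lie_smul r s f := VectorFields.deriv_const_smul _ r f

/-- The anchor as a morphism `L → Vect(N)` of Lie-Rinehart algebras over `A`. -/
noncomputable def anchorHom :
    LieRinehartAlgebra.Hom (AlgHom.id ℝ (SmoothFunctions E N)) 𝓛.Sections (VectorFields E N) where
  toFun s := 𝓛.anchorMap s
  map_add' s t := 𝓛.anchorMap.map_add s t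
  map_smul' r s := by
    rw [← algebraMap_smul (SmoothFunctions E N) r s, map_smul, algebraMap_smul]
    rfl
  map_lie' {s t} := 𝓛.anchorMap_lie s t
  map_smul_apply' f s := 𝓛.anchorMap.map_smul f s
  apply_lie' _ _ := rfl

/-- The distribution of tangent subspaces given by the image of the anchor. -/
noncomputable def distribution (x : N) : Submodule ℝ (TangentSpace 𝓘(ℝ, E) x) :=
  LinearMap.range (𝓛.anchor.toFun x)

/-- The total space of the dual bundle. -/
abbrev DualSpace (_ : LieAlgebroid E F V) : Type _ :=
  TotalSpace (F →L[ℝ] ℝ) (fun x : N => V x →L[ℝ] Bundle.Trivial N ℝ x)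

/-- The homomorphism from the symmetric `A`-algebra of `L` to functions on the dual bundle which
sends `f ∈ A` to `ξ ↦ f (π ξ)` and `s ∈ L` to `ξ ↦ ξ (s (π ξ))`. -/
noncomputable def toFunctions :
    SymmetricAlgebra (SmoothFunctions E N) 𝓛.Sections →+* (𝓛.DualSpace → ℝ) :=
  LieRinehartAlgebra.symmLift
    (RingHom.pi fun ξ => ContMDiffMap.evalRingHom (I := 𝓘(ℝ, E)) ξ.1)
    { toFun := fun s ξ => ξ.2 (𝓛.value s ξ.1)
      map_zero' := funext fun ξ => ξ.2.map_zero
      map_add' := fun s t => funext fun ξ => ξ.2.map_add (𝓛.value s ξ.1) (𝓛.value t ξ.1) }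
    (fun f s => funext fun ξ => ξ.2.map_smul (f ξ.1) (𝓛.value s ξ.1))

theorem toFunctions_algebraMap (f : SmoothFunctions E N) (ξ : 𝓛.DualSpace) :
    𝓛.toFunctions (algebraMap _ _ f) ξ = f ξ.1 :=
  congr_fun (LieRinehartAlgebra.symmLift_algebraMap _ _ _ f) ξ

theorem toFunctions_ι (s : 𝓛.Sections) (ξ : 𝓛.DualSpace) :
    𝓛.toFunctions (SymmetricAlgebra.ι _ _ s) ξ = ξ.2 (𝓛.value s ξ.1) :=
  congr_fun (LieRinehartAlgebra.symmLift_ι _ _ _ s) ξ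

/-- A smooth function on the total space of the dual bundle which is polynomial on the fibres, of
bounded degree. -/
def IsSmoothFibrewisePolynomial [ContMDiffVectorBundle ∞ F V 𝓘(ℝ, E)] (f : 𝓛.DualSpace → ℝ) :
    Prop :=
  ContMDiff (𝓘(ℝ, E).prod 𝓘(ℝ, F →L[ℝ] ℝ)) 𝓘(ℝ, ℝ) ∞ f ∧
  ∃ d : ℕ, ∀ x : N, ∃ P : MvPolynomial (V x) ℝ, P.totalDegree ≤ d ∧
    ∀ ξ : V x →L[ℝ] Bundle.Trivial N ℝ x, f ⟨x, ξ⟩ = MvPolynomial.eval (fun v => ξ v) P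

end LieAlgebroid

end LieAlgebroids

end LieAlgebroidTheory

/-! The geometric input is one construction: a morphism $\rho$ of vector bundles of constant rank
has a smooth generalized inverse $\sigma$, meaning $\rho\sigma\rho=\rho$. Near a point where $\rho$
equals $\rho_0$, choose $S_0$ with $\rho_0S_0\rho_0=\rho_0$ and $S_0\rho_0S_0=S_0$; then $S_0(\rho
S_0+1-\rho_0S_0)^{-1}$ works in coordinates. The equation is affine in $\sigma$, so a partition of
unity glues the local solutions (`exists_contMDiffSection_generalized_inverse`).

For the anchor, every vector field $X$ tangent to $D$ satisfies $\lambda(\sigma X)=X$. Hence $L''$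
consists of all fields tangent to $D$, involutivity of $D$ is closure of the image under brackets,
and $\sigma$ restricted to $L''$ is a connection. A function constant on leaves is killed by fields
tangent to $D$, since short pieces of their integral curves stay in a leaf; by the Leibniz rule it
is a Casimir element. A Poisson bracket on $S_A[L]$ is determined on the generators $A$ and
$L=\omega(L'')+L'$, which gives the uniqueness in terms of curvature (`Connection.describes_iff`).

The function model of $S_A[L]$ rests on a finite family of sections $e_j$ spanning every fibre. Over
a compact set a general position argument bounds their number by $\dim N+\operatorname{rank}\mathcal
L$, and the shells of an exhaustion can then be handled in three disjointly supported classes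
(`exists_spansOn_univ`). A generalized inverse of the surjection $N\times\mathbb R^m\to\mathcal L$
provides dual sections $\sigma_j$ with $v=\sum\sigma_j(v)e_j$ (`exists_finite_dual_frame`). So $L$
is a direct summand of $A^m$ and $S_A[L]$ a retract of $A[X_1,\dots,X_m]$, where both injectivity
and surjectivity become statements about real polynomials whose coefficients depend smoothly on the
point. -/

section

set_option linter.unusedSectionVars false

open Bundle Manifold LieRinehartAlgebra
open scoped Topology

namespace LieAlgebroidTheory

open scoped ContDiff

/-! ### Generalized inverses of linear maps in families of constant rank -/

section GeneralizedInverse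

variable {F₁ F₂ : Type*} [NormedAddCommGroup F₁] [NormedSpace ℝ F₁] [FiniteDimensional ℝ F₁]
  [NormedAddCommGroup F₂] [NormedSpace ℝ F₂] [FiniteDimensional ℝ F₂]

/-- Project onto the range of `T`, then apply a linear right inverse of `T` on that range. The
second identity is needed for the perturbation argument below. -/
theorem exists_reflexive_generalized_inverse (T : F₁ →L[ℝ] F₂) :
    ∃ S : F₂ →L[ℝ] F₁, (∀ v, T (S (T v)) = T v) ∧ ∀ w, S (T (S w)) = S w := by
  obtain ⟨g, hg⟩ := T.toLinearMap.rangeRestrict.exists_rightInverse_of_surjective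
    (LinearMap.range_rangeRestrict _)
  obtain ⟨p, hp⟩ := (LinearMap.range T.toLinearMap).subtype.exists_leftInverse_of_injective
    (Submodule.ker_subtype _)
  have hTg (y : LinearMap.range T.toLinearMap) : T (g y) = y :=
    congr_arg Subtype.val (LinearMap.congr_fun hg y)
  have hp' (y : LinearMap.range T.toLinearMap) : p y = y := LinearMap.congr_fun hp y
  have hpT (v : F₁) : (p (T v) : F₂) = T v := congr_arg Subtype.val (hp' ⟨T v, v, rfl⟩)
  refine ⟨LinearMap.toContinuousLinearMap (g ∘ₗ p), fun v => ?_, fun w => ?_⟩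
  · simp only [LinearMap.coe_toContinuousLinearMap', LinearMap.comp_apply, hTg, hpT]
  · simp only [LinearMap.coe_toContinuousLinearMap', LinearMap.comp_apply, hTg, hp']

/-- If `S₀` is a reflexive generalized inverse of `T₀` and `G = T S₀ + (1 - T₀ S₀)` is invertible,
then `S₀ G⁻¹` is a generalized inverse of every `T` of the same rank as `T₀`. -/
theorem generalized_inverse_of_rank_eq {T₀ T : F₁ →L[ℝ] F₂} {S₀ G' : F₂ →L[ℝ] F₁}
    {J : F₂ →L[ℝ] F₂} (h1 : ∀ v, T₀ (S₀ (T₀ v)) = T₀ v) (h2 : ∀ w, S₀ (T₀ (S₀ w)) = S₀ w)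
    (hrank : Module.finrank ℝ (LinearMap.range T.toLinearMap) =
      Module.finrank ℝ (LinearMap.range T₀.toLinearMap))
    (hJ : ∀ w, J (T (S₀ w) + (w - T₀ (S₀ w))) = w) (hG : G' = S₀ ∘L J) (v : F₁) :
    T (G' (T v)) = T v := by
  -- With `G = T S₀ + (1 - T₀ S₀)`, reflexivity of `S₀` gives `G T₀ S₀ = T S₀`; `J` is a left
  -- inverse of `G`.
  have hJT (w : F₂) : J (T (S₀ w)) = T₀ (S₀ w) := by
    have := hJ (T₀ (S₀ w))
    rwa [h2, sub_self, add_zero] at this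
  have hle : Submodule.map T.toLinearMap (LinearMap.range S₀.toLinearMap) ≤
      LinearMap.range T.toLinearMap := LinearMap.map_le_range
  have hmap : Submodule.map J.toLinearMap
      (Submodule.map T.toLinearMap (LinearMap.range S₀.toLinearMap)) =
      LinearMap.range T₀.toLinearMap := by
    ext y
    constructor
    · rintro ⟨_, ⟨_, ⟨w, rfl⟩, rfl⟩, rfl⟩
      exact ⟨S₀ w, (hJT w).symm⟩
    · rintro ⟨u, rfl⟩
      exact ⟨_, ⟨_, ⟨T₀ u, rfl⟩, rfl⟩, (hJT _).trans (h1 u)⟩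
  -- `J` maps `T (range S₀)` onto `range T₀`, so its dimension is at least the common rank and it
  -- fills `range T`. Only here does the rank hypothesis enter.
  have heq : Submodule.map T.toLinearMap (LinearMap.range S₀.toLinearMap) =
      LinearMap.range T.toLinearMap := by
    refine Submodule.eq_of_le_of_finrank_le hle ?_
    rw [hrank, ← hmap]
    exact Submodule.finrank_map_le _ _
  obtain ⟨_, ⟨w, rfl⟩, hw⟩ := heq.ge ⟨v, rfl⟩
  change T (S₀ w) = T v at hw
  rw [← hw, hG]
  change T (S₀ (J (T (S₀ w)))) = _
  rw [hJT, h2]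

variable {E : Type*} [NormedAddCommGroup E] [NormedSpace ℝ E]
  {N : Type*} [TopologicalSpace N] [ChartedSpace E N]

/-- The operator `G` equals the identity at `x₀`, hence is invertible nearby, and inversion is
smooth on units. Smoothness is tracked at all points near `x₀`, because gluing needs local solutions
that are smooth on a neighbourhood. -/
theorem exists_contMDiffAt_generalized_inverse {R : N → F₁ →L[ℝ] F₂} {x₀ : N} {n : WithTop ℕ∞}
    (hR : ∀ᶠ x in 𝓝 x₀, ContMDiffAt 𝓘(ℝ, E) 𝓘(ℝ, F₁ →L[ℝ] F₂) n R x)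
    (hrank : ∀ᶠ x in 𝓝 x₀, Module.finrank ℝ (LinearMap.range (R x).toLinearMap) =
      Module.finrank ℝ (LinearMap.range (R x₀).toLinearMap)) :
    ∃ S : N → F₂ →L[ℝ] F₁, (∀ᶠ x in 𝓝 x₀, ContMDiffAt 𝓘(ℝ, E) 𝓘(ℝ, F₂ →L[ℝ] F₁) n S x) ∧
      ∀ᶠ x in 𝓝 x₀, ∀ v, R x (S x (R x v)) = R x v := by
  have := FiniteDimensional.complete ℝ F₂
  obtain ⟨S₀, h1, h2⟩ := exists_reflexive_generalized_inverse (R x₀)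
  let G : N → F₂ →L[ℝ] F₂ := fun x => R x ∘L S₀ + (1 - R x₀ ∘L S₀)
  have hG (x : N) (hx : ContMDiffAt 𝓘(ℝ, E) 𝓘(ℝ, F₁ →L[ℝ] F₂) n R x) :
      ContMDiffAt 𝓘(ℝ, E) 𝓘(ℝ, F₂ →L[ℝ] F₂) n G x :=
    (hx.clm_comp contMDiffAt_const).add contMDiffAt_const
  have hG0 : G x₀ = 1 := by simp [G]
  have hunit : ∀ᶠ x in 𝓝 x₀, IsUnit (G x) :=
    (hG x₀ hR.self_of_nhds).continuousAt.eventually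
      (Units.isOpen.mem_nhds (by rw [hG0]; exact isUnit_one))
  have hJ (x : N) (hu : IsUnit (G x)) (hx : ContMDiffAt 𝓘(ℝ, E) 𝓘(ℝ, F₁ →L[ℝ] F₂) n R x) :
      ContMDiffAt 𝓘(ℝ, E) 𝓘(ℝ, F₂ →L[ℝ] F₂) n (fun x => Ring.inverse (G x)) x := by
    obtain ⟨u, hu⟩ := hu
    have h := contDiffAt_ringInverse ℝ (n := n) u
    rw [hu] at h
    exact ContDiffAt.comp_contMDiffAt (g := Ring.inverse) (f := G) h (hG x hx)
  refine ⟨fun x => S₀ ∘L Ring.inverse (G x), ?_, ?_⟩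
  · filter_upwards [hunit, hR] with x hu hx
    exact contMDiffAt_const.clm_comp (hJ x hu hx)
  filter_upwards [hrank, hunit] with x hx hu v
  refine generalized_inverse_of_rank_eq (J := Ring.inverse (G x)) h1 h2 hx (fun w => ?_) rfl v
  exact congr($(Ring.inverse_mul_cancel (G x) hu) w)

end GeneralizedInverse

/-! ### Topological vector space structure of the fibres -/

section FibreTopology

/-- A trivialization is a linear homeomorphism from the fibre to `F`, so this and the next three
properties are transported from `F`. They are what bundles of continuous linear maps, and automatic
continuity on fibres, require. -/
theorem isTopologicalAddGroup_fibre {B : Type*} (F : Type*) [TopologicalSpace B] [NormedAddCommGroup F]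
    [NormedSpace ℝ F] (V : B → Type*) [TopologicalSpace (TotalSpace F V)]
    [∀ x, TopologicalSpace (V x)] [FiberBundle F V] [∀ x, AddCommGroup (V x)]
    [∀ x, Module ℝ (V x)] [VectorBundle ℝ F V] (x : B) :
    IsTopologicalAddGroup (V x) :=
  let e := (trivializationAt F V x).continuousLinearEquivAt ℝ x
    (mem_baseSet_trivializationAt F V x)
  e.toHomeomorph.isInducing.topologicalAddGroup e.toLinearEquiv

theorem continuousSMul_fibre {B : Type*} (F : Type*) [TopologicalSpace B] [NormedAddCommGroup F]
    [NormedSpace ℝ F] (V : B → Type*) [TopologicalSpace (TotalSpace F V)]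
    [∀ x, TopologicalSpace (V x)] [FiberBundle F V] [∀ x, AddCommGroup (V x)]
    [∀ x, Module ℝ (V x)] [VectorBundle ℝ F V] (x : B) :
    ContinuousSMul ℝ (V x) :=
  let e := (trivializationAt F V x).continuousLinearEquivAt ℝ x
    (mem_baseSet_trivializationAt F V x)
  e.toHomeomorph.isInducing.continuousSMul continuous_id (e.map_smul _ _)

theorem t2Space_fibre {B : Type*} (F : Type*) [TopologicalSpace B] [NormedAddCommGroup F]
    [NormedSpace ℝ F] (V : B → Type*) [TopologicalSpace (TotalSpace F V)]
    [∀ x, TopologicalSpace (V x)] [FiberBundle F V] [∀ x, AddCommGroup (V x)]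
    [∀ x, Module ℝ (V x)] [VectorBundle ℝ F V] (x : B) :
    T2Space (V x) :=
  let e := (trivializationAt F V x).continuousLinearEquivAt ℝ x
    (mem_baseSet_trivializationAt F V x)
  e.toHomeomorph.symm.t2Space

theorem finiteDimensional_fibre {B : Type*} (F : Type*) [TopologicalSpace B] [NormedAddCommGroup F]
    [NormedSpace ℝ F] (V : B → Type*) [TopologicalSpace (TotalSpace F V)]
    [∀ x, TopologicalSpace (V x)] [FiberBundle F V] [∀ x, AddCommGroup (V x)]
    [∀ x, Module ℝ (V x)] [VectorBundle ℝ F V]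
    [FiniteDimensional ℝ F] (x : B) : FiniteDimensional ℝ (V x) :=
  let e := (trivializationAt F V x).continuousLinearEquivAt ℝ x
    (mem_baseSet_trivializationAt F V x)
  e.symm.toLinearEquiv.finiteDimensional

end FibreTopology

/-! ### Smoothness of morphisms of vector bundles -/

section Morphisms

variable {E : Type*} [NormedAddCommGroup E] [NormedSpace ℝ E]
  {N : Type*} [TopologicalSpace N] [ChartedSpace E N]
  {F₁ : Type*} [NormedAddCommGroup F₁] [NormedSpace ℝ F₁]
  {F₂ : Type*} [NormedAddCommGroup F₂] [NormedSpace ℝ F₂]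
  {V : N → Type*} [TopologicalSpace (TotalSpace F₁ V)] [∀ x, TopologicalSpace (V x)]
  [FiberBundle F₁ V] [∀ x, AddCommGroup (V x)] [∀ x, Module ℝ (V x)] [VectorBundle ℝ F₁ V]
  {W : N → Type*} [TopologicalSpace (TotalSpace F₂ W)] [∀ x, TopologicalSpace (W x)]
  [FiberBundle F₂ W] [∀ x, AddCommGroup (W x)] [∀ x, Module ℝ (W x)] [VectorBundle ℝ F₂ W]

/-- In a basis $b$ one has $f=\sum_i b_i^*\otimes f(b_i)$, a finite sum of fixed continuous linear
images of the functions $f(b_i)$. -/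
theorem contMDiffAt_clm_of_apply [FiniteDimensional ℝ F₁] {f : N → F₁ →L[ℝ] F₂} {x₀ : N}
    {n : WithTop ℕ∞}
    (h : ∀ v, ContMDiffAt 𝓘(ℝ, E) 𝓘(ℝ, F₂) n (fun x => f x v) x₀) :
    ContMDiffAt 𝓘(ℝ, E) 𝓘(ℝ, F₁ →L[ℝ] F₂) n f x₀ := by
  let b := Module.finBasis ℝ F₁
  have hf : f = fun x => ∑ i, ContinuousLinearMap.smulRightL ℝ F₁ F₂
      (LinearMap.toContinuousLinearMap (b.coord i)) (f x (b i)) := by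
    ext x v
    conv_lhs => rw [← b.sum_repr v, map_sum]
    simp
  rw [hf]
  exact contMDiffAt_finsetSum fun i _ => (ContinuousLinearMap.contMDiff _).contMDiffAt.comp x₀ (h _)

theorem contMDiffAt_hom_section_iff [ContMDiffVectorBundle ∞ F₁ V 𝓘(ℝ, E)]
    [ContMDiffVectorBundle ∞ F₂ W 𝓘(ℝ, E)]
    [∀ x, IsTopologicalAddGroup (W x)] [∀ x, ContinuousSMul ℝ (W x)]
    [IsManifold 𝓘(ℝ, E) ∞ N]
    {φ : ∀ x, V x →L[ℝ] W x} {x₀ x : N} (hx : x ∈ (trivializationAt F₁ V x₀).baseSet)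
    (hx' : x ∈ (trivializationAt F₂ W x₀).baseSet) :
    ContMDiffAt 𝓘(ℝ, E) (𝓘(ℝ, E).prod 𝓘(ℝ, F₁ →L[ℝ] F₂)) ∞
      (fun x => TotalSpace.mk' (F₁ →L[ℝ] F₂) (E := fun x => V x →L[ℝ] W x) x (φ x)) x ↔
    ContMDiffAt 𝓘(ℝ, E) 𝓘(ℝ, F₁ →L[ℝ] F₂) ∞
      (fun x => ContinuousLinearMap.inCoordinates F₁ V F₂ W x₀ x x₀ x (φ x)) x :=
  (trivializationAt (F₁ →L[ℝ] F₂) (fun x => V x →L[ℝ] W x) x₀).contMDiffAt_section_iff ⟨hx, hx'⟩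

/-- A family of linear maps between the fibres of two vector bundles is smooth if it maps the
constant local sections of a trivialization to smooth local sections. -/
theorem contMDiffAt_hom_of_symm [FiniteDimensional ℝ F₁]
    [∀ x, IsTopologicalAddGroup (W x)] [∀ x, ContinuousSMul ℝ (W x)]
    {φ : ∀ x, V x →L[ℝ] W x} {x₀ : N} {n : WithTop ℕ∞}
    (h : ∀ v, ContMDiffAt 𝓘(ℝ, E) (𝓘(ℝ, E).prod 𝓘(ℝ, F₂)) n
      (fun x => TotalSpace.mk' F₂ x (φ x ((trivializationAt F₁ V x₀).symm x v))) x₀) :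
    ContMDiffAt 𝓘(ℝ, E) (𝓘(ℝ, E).prod 𝓘(ℝ, F₁ →L[ℝ] F₂)) n
      (fun x => TotalSpace.mk' (F₁ →L[ℝ] F₂) (E := fun x => V x →L[ℝ] W x) x (φ x)) x₀ := by
  rw [contMDiffAt_hom_bundle]
  refine ⟨contMDiffAt_id, contMDiffAt_clm_of_apply fun v => ?_⟩
  have hv := (contMDiffAt_section x₀).1 (h v)
  refine hv.congr_of_eventuallyEq ?_
  filter_upwards [(trivializationAt F₁ V x₀).open_baseSet.mem_nhds
      (mem_baseSet_trivializationAt F₁ V x₀), (trivializationAt F₂ W x₀).open_baseSet.mem_nhds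
      (mem_baseSet_trivializationAt F₂ W x₀)] with x hx hx'
  rw [ContinuousLinearMap.inCoordinates_eq hx hx']
  rfl

/-- These are the test sections required by `contMDiffAt_hom_of_symm`. -/
theorem contMDiffAt_symm_section [ContMDiffVectorBundle ∞ F₁ V 𝓘(ℝ, E)] (x₀ : N) (v : F₁) :
    ContMDiffAt 𝓘(ℝ, E) (𝓘(ℝ, E).prod 𝓘(ℝ, F₁)) ∞
      (fun x => TotalSpace.mk' F₁ x ((trivializationAt F₁ V x₀).symm x v)) x₀ := by
  rw [contMDiffAt_section]
  refine (contMDiffAt_const (c := v)).congr_of_eventuallyEq ?_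
  filter_upwards [(trivializationAt F₁ V x₀).open_baseSet.mem_nhds
      (mem_baseSet_trivializationAt F₁ V x₀)] with x hx
  rw [Trivialization.apply_mk_symm _ hx]

end Morphisms

/-! ### Global generalized inverses by partition of unity -/

section GlobalInverse

variable {E : Type*} [NormedAddCommGroup E] [NormedSpace ℝ E] [FiniteDimensional ℝ E]
  {N : Type*} [TopologicalSpace N] [T2Space N] [SigmaCompactSpace N]
  [ChartedSpace E N] [IsManifold 𝓘(ℝ, E) ∞ N]
  {F₁ : Type*} [NormedAddCommGroup F₁] [NormedSpace ℝ F₁] [FiniteDimensional ℝ F₁]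
  {F₂ : Type*} [NormedAddCommGroup F₂] [NormedSpace ℝ F₂] [FiniteDimensional ℝ F₂]
  {V : N → Type*} [TopologicalSpace (TotalSpace F₁ V)] [∀ x, TopologicalSpace (V x)]
  [FiberBundle F₁ V] [∀ x, AddCommGroup (V x)] [∀ x, Module ℝ (V x)] [VectorBundle ℝ F₁ V]
  [∀ x, IsTopologicalAddGroup (V x)] [∀ x, ContinuousSMul ℝ (V x)]
  [ContMDiffVectorBundle ∞ F₁ V 𝓘(ℝ, E)]
  {W : N → Type*} [TopologicalSpace (TotalSpace F₂ W)] [∀ x, TopologicalSpace (W x)]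
  [FiberBundle F₂ W] [∀ x, AddCommGroup (W x)] [∀ x, Module ℝ (W x)] [VectorBundle ℝ F₂ W]
  [∀ x, IsTopologicalAddGroup (W x)] [∀ x, ContinuousSMul ℝ (W x)]
  [ContMDiffVectorBundle ∞ F₂ W 𝓘(ℝ, E)]

/-- A morphism of vector bundles of constant rank has a smooth generalized inverse. -/
theorem exists_contMDiffSection_generalized_inverse (ρ : ∀ x, V x →L[ℝ] W x)
    (hρ : ContMDiff 𝓘(ℝ, E) (𝓘(ℝ, E).prod 𝓘(ℝ, F₁ →L[ℝ] F₂)) ∞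
      (fun x => TotalSpace.mk' (F₁ →L[ℝ] F₂) (E := fun x => V x →L[ℝ] W x) x (ρ x)))
    (r : ℕ) (hr : ∀ x, Module.finrank ℝ (LinearMap.range (ρ x).toLinearMap) = r) :
    ∃ σ : Cₛ^∞⟮𝓘(ℝ, E); F₂ →L[ℝ] F₁, fun x => W x →L[ℝ] V x⟯,
      ∀ x v, ρ x (σ x (ρ x v)) = ρ x v := by
  -- The condition $\rho s\rho=\rho$ is affine in $s$, so its solutions in each fibre form a convex
  -- set. The reflexive condition $s\rho s=s$ is quadratic and is therefore not imposed.
  refine exists_contMDiffSection_forall_mem_convex_of_local 𝓘(ℝ, E) (n := ⊤)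
    (fun x => W x →L[ℝ] V x) (fun x => {s | ∀ v, ρ x (s (ρ x v)) = ρ x v}) (fun x => ?_)
    (fun x₀ => ?_)
  · intro s hs t ht a b _ _ hab v
    simp only [add_apply, smul_apply, map_add, map_smul,
      hs v, ht v, ← add_smul, hab, one_smul]
  · set e := trivializationAt F₁ V x₀
    set e' := trivializationAt F₂ W x₀
    have he := e.open_baseSet.mem_nhds (mem_baseSet_trivializationAt F₁ V x₀)
    have he' := e'.open_baseSet.mem_nhds (mem_baseSet_trivializationAt F₂ W x₀)
    have hrank : ∀ x ∈ e.baseSet, x ∈ e'.baseSet → Module.finrank ℝ (LinearMap.range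
        (ContinuousLinearMap.inCoordinates F₁ V F₂ W x₀ x x₀ x (ρ x)).toLinearMap) = r := by
      intro x hx hx'
      rw [ContinuousLinearMap.inCoordinates_eq hx hx', ← hr x]
      have h1 : LinearMap.range ((e'.continuousLinearEquivAt ℝ x hx' : W x →L[ℝ] F₂) ∘L ρ x ∘L
          ((e.continuousLinearEquivAt ℝ x hx).symm : F₁ →L[ℝ] V x)).toLinearMap =
          (LinearMap.range (ρ x).toLinearMap).map
            (e'.continuousLinearEquivAt ℝ x hx').toLinearEquiv.toLinearMap := by
        ext y
        constructor
        · rintro ⟨w, rfl⟩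
          exact ⟨_, ⟨_, rfl⟩, rfl⟩
        · rintro ⟨_, ⟨v, rfl⟩, rfl⟩
          refine ⟨e.continuousLinearEquivAt ℝ x hx v, ?_⟩
          change e'.continuousLinearEquivAt ℝ x hx' (ρ x ((e.continuousLinearEquivAt ℝ x hx).symm
            (e.continuousLinearEquivAt ℝ x hx v))) = _
          rw [ContinuousLinearEquiv.symm_apply_apply]
          rfl
      rw [h1]
      exact LinearEquiv.finrank_map_eq _ _
    obtain ⟨S, hS, hRS⟩ := exists_contMDiffAt_generalized_inverse (x₀ := x₀) (n := ∞)
      (R := fun x => ContinuousLinearMap.inCoordinates F₁ V F₂ W x₀ x x₀ x (ρ x)) (by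
        filter_upwards [he, he'] with x hx hx'
        exact (contMDiffAt_hom_section_iff hx hx').1 (hρ x)) (by
        filter_upwards [he, he'] with x hx hx'
        rw [hrank x hx hx', hrank x₀ (mem_baseSet_trivializationAt F₁ V x₀)
          (mem_baseSet_trivializationAt F₂ W x₀)])
    -- Both trivialization maps are total in `x`, so `s` is defined everywhere; it is meaningful
    -- only over the two base sets, where its coordinate expression is `S`.
    let s : ∀ x, W x →L[ℝ] V x := fun x => e.symmL ℝ x ∘L S x ∘L e'.continuousLinearMapAt ℝ x
    have hs (x : N) (hx : x ∈ e.baseSet) (hx' : x ∈ e'.baseSet) :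
        ContinuousLinearMap.inCoordinates F₂ W F₁ V x₀ x x₀ x (s x) = S x := by
      ext w
      rw [ContinuousLinearMap.inCoordinates_eq hx' hx]
      change e.continuousLinearEquivAt ℝ x hx (e.symmL ℝ x (S x (e'.continuousLinearMapAt ℝ x
        ((e'.continuousLinearEquivAt ℝ x hx').symm w)))) = _
      rw [← Trivialization.coe_continuousLinearEquivAt_eq' e' hx',
        ← Trivialization.symm_continuousLinearEquivAt_eq' e hx]
      simp only [ContinuousLinearEquiv.coe_coe, ContinuousLinearEquiv.apply_symm_apply]
    have hU : ∀ᶠ x in 𝓝 x₀, ContMDiffAt 𝓘(ℝ, E) (𝓘(ℝ, E).prod 𝓘(ℝ, F₂ →L[ℝ] F₁)) ∞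
        (fun x => TotalSpace.mk' (F₂ →L[ℝ] F₁) (E := fun x => W x →L[ℝ] V x) x (s x)) x ∧
        ∀ v, ρ x (s x (ρ x v)) = ρ x v := by
      filter_upwards [he, he', hS, hRS] with x hx hx' hSx hx''
      constructor
      · rw [contMDiffAt_hom_section_iff hx' hx]
        refine hSx.congr_of_eventuallyEq ?_
        filter_upwards [e.open_baseSet.mem_nhds hx, e'.open_baseSet.mem_nhds hx'] with y hy hy'
        exact hs y hy hy'
      · intro v
        have h := hx'' (e.continuousLinearEquivAt ℝ x hx v)
        rw [ContinuousLinearMap.inCoordinates_eq hx hx'] at h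
        have h' : ρ x ((e.continuousLinearEquivAt ℝ x hx).symm (S x
            (e'.continuousLinearEquivAt ℝ x hx' (ρ x ((e.continuousLinearEquivAt ℝ x hx).symm
            (e.continuousLinearEquivAt ℝ x hx v)))))) = ρ x ((e.continuousLinearEquivAt ℝ x hx).symm
            (e.continuousLinearEquivAt ℝ x hx v)) :=
          (e'.continuousLinearEquivAt ℝ x hx').injective h
        rw [ContinuousLinearEquiv.symm_apply_apply] at h'
        change ρ x (e.symmL ℝ x (S x (e'.continuousLinearMapAt ℝ x (ρ x v)))) = _
        rw [← Trivialization.coe_continuousLinearEquivAt_eq' e' hx',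
          ← Trivialization.symm_continuousLinearEquivAt_eq' e hx]
        exact h'
    exact ⟨_, hU, s, fun x hx => hx.1.contMDiffWithinAt, fun x hx => hx.2⟩

end GlobalInverse

end LieAlgebroidTheory

namespace LieAlgebroidTheory

open scoped ContDiff

/-! ### Finite spanning families of sections and dual frames -/

section Frames

variable {E : Type*} [NormedAddCommGroup E] [NormedSpace ℝ E] [FiniteDimensional ℝ E]
  {N : Type*} [TopologicalSpace N] [T2Space N] [SigmaCompactSpace N]
  [ChartedSpace E N] [IsManifold 𝓘(ℝ, E) ∞ N]
  {F : Type*} [NormedAddCommGroup F] [NormedSpace ℝ F]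
  {V : N → Type*} [TopologicalSpace (TotalSpace F V)] [∀ x, TopologicalSpace (V x)]
  [FiberBundle F V] [∀ x, AddCommGroup (V x)] [∀ x, Module ℝ (V x)] [VectorBundle ℝ F V]
  [ContMDiffVectorBundle ∞ F V 𝓘(ℝ, E)]

/-- A local section can be extended from a closed subset of its domain. -/
theorem exists_contMDiffSection_eqOn {K U : Set N} (hK : IsClosed K) (hU : IsOpen U) (hKU : K ⊆ U)
    {s : ∀ x, V x} (hs : ContMDiffOn 𝓘(ℝ, E) (𝓘(ℝ, E).prod 𝓘(ℝ, F)) ∞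
      (fun x => TotalSpace.mk' F x (s x)) U) :
    ∃ t : Cₛ^∞⟮𝓘(ℝ, E); F, V⟯, ∀ x ∈ K, t x = s x := by
  -- The constraint prescribes one vector over `K` and nothing elsewhere, hence is convex. Local
  -- solutions are `s` near points of `K` and the zero section on the open complement.
  refine exists_contMDiffSection_forall_mem_convex_of_local 𝓘(ℝ, E) (n := ⊤)
    V (fun x => {v | x ∈ K → v = s x}) (fun x => ?_) (fun x₀ => ?_)
  · intro v hv w hw a b _ _ hab hx
    rw [hv hx, hw hx, ← add_smul, hab, one_smul]
  · by_cases hx : x₀ ∈ K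
    · exact ⟨U, hU.mem_nhds (hKU hx), s, hs, fun y _ _ => rfl⟩
    · exact ⟨Kᶜ, hK.isOpen_compl.mem_nhds hx, fun x => 0,
        (contMDiff_zeroSection ℝ V).contMDiffOn, fun y hy hy' => absurd hy' hy⟩

theorem contMDiffOn_symm_section (x₀ : N) (v : F) :
    ContMDiffOn 𝓘(ℝ, E) (𝓘(ℝ, E).prod 𝓘(ℝ, F)) ∞
      (fun x => TotalSpace.mk' F x ((trivializationAt F V x₀).symm x v))
      (trivializationAt F V x₀).baseSet := by
  rw [Trivialization.contMDiffOn_section_baseSet_iff]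
  refine (contMDiffOn_const (c := v)).congr fun x hx => ?_
  rw [Trivialization.apply_mk_symm _ hx]

theorem exists_contMDiffSection_apply_eq (x₀ : N) (v : V x₀) :
    ∃ t : Cₛ^∞⟮𝓘(ℝ, E); F, V⟯, t x₀ = v := by
  obtain ⟨t, ht⟩ := exists_contMDiffSection_eqOn (isClosed_singleton (x := x₀))
    (trivializationAt F V x₀).open_baseSet
    (Set.singleton_subset_iff.2 (mem_baseSet_trivializationAt F V x₀))
    (contMDiffOn_symm_section (E := E) x₀ ((trivializationAt F V x₀) ⟨x₀, v⟩).2)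
  refine ⟨t, (ht x₀ rfl).trans ?_⟩
  exact Trivialization.symm_apply_apply_mk _ (mem_baseSet_trivializationAt F V x₀) v

variable (V) in
/-- A family of sections spans the fibres over `K`: no nonzero linear form on such a fibre
vanishes on all of them. -/
def SpansOn {ι : Type*} (s : ι → Cₛ^∞⟮𝓘(ℝ, E); F, V⟯) (K : Set N) : Prop :=
  ∀ x ∈ K, ∀ ξ : V x →ₗ[ℝ] ℝ, (∀ i, ξ (s i x) = 0) → ξ = 0

variable [FiniteDimensional ℝ F]

/-- The constant frame of a trivialization, restricted to a closed neighbourhood inside the base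
set, extends to global sections. -/
theorem exists_spansOn_nhds (x₀ : N) : ∃ K ∈ 𝓝 x₀,
    ∃ s : Fin (Module.finrank ℝ F) → Cₛ^∞⟮𝓘(ℝ, E); F, V⟯, SpansOn V s K := by
  have := Manifold.locallyCompact_of_finiteDimensional (M := N) 𝓘(ℝ, E)
  set e := trivializationAt F V x₀ with he
  obtain ⟨K, hKn, hK, hKe⟩ := exists_mem_nhds_isClosed_subset
    (e.open_baseSet.mem_nhds (mem_baseSet_trivializationAt F V x₀))
  let b := Module.finBasis ℝ F
  have h (i) := exists_contMDiffSection_eqOn hK e.open_baseSet hKe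
    (contMDiffOn_symm_section (E := E) x₀ (b i))
  choose s hs using h
  refine ⟨K, hKn, s, fun x hx ξ hξ => ?_⟩
  let e' := (e.continuousLinearEquivAt ℝ x (hKe hx)).toLinearEquiv
  have h1 : ξ ∘ₗ e'.symm.toLinearMap = 0 := b.ext fun i => by
    have := hξ i
    rw [hs i x hx] at this
    exact this
  ext v
  have := LinearMap.congr_fun h1 (e' v)
  rw [LinearMap.comp_apply, LinearEquiv.coe_coe, LinearEquiv.symm_apply_apply] at this
  exact this

/-- Spanning passes to unions of families, so compactness suffices. The number of sections is still
uncontrolled here. -/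
theorem exists_spansOn_of_isCompact {K : Set N} (hK : IsCompact K) :
    ∃ (m : ℕ) (s : Fin m → Cₛ^∞⟮𝓘(ℝ, E); F, V⟯), SpansOn V s K := by
  classical
  obtain ⟨T, hT⟩ : ∃ T : Finset Cₛ^∞⟮𝓘(ℝ, E); F, V⟯, SpansOn V (fun i : T => i.1) K := by
    refine hK.induction_on (p := fun K => ∃ T : Finset Cₛ^∞⟮𝓘(ℝ, E); F, V⟯,
      SpansOn V (fun i : T => i.1) K) ⟨∅, fun x hx => hx.elim⟩ ?_ ?_ ?_
    · rintro s t hst ⟨T, hT⟩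
      exact ⟨T, fun x hx => hT x (hst hx)⟩
    · rintro s t ⟨T, hT⟩ ⟨T', hT'⟩
      refine ⟨T ∪ T', ?_⟩
      rintro x (hx | hx) ξ hξ
      · exact hT x hx ξ fun i => hξ ⟨i.1, Finset.mem_union_left _ i.2⟩
      · exact hT' x hx ξ fun i => hξ ⟨i.1, Finset.mem_union_right _ i.2⟩
    · intro x _
      obtain ⟨U, hU, s, hs⟩ := exists_spansOn_nhds (E := E) (F := F) (V := V) x
      refine ⟨U, mem_nhdsWithin_of_mem_nhds hU, Finset.univ.image s, fun y hy ξ hξ => ?_⟩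
      exact hs y hy ξ fun i => hξ ⟨s i, Finset.mem_image_of_mem _ (Finset.mem_univ i)⟩
  refine ⟨T.card, fun i => (T.equivFin.symm i).1, fun x hx ξ hξ => hT x hx ξ fun i => ?_⟩
  simpa using hξ (T.equivFin i)

/-- The values of linear forms on `m` given sections form a subset of `ℝ^m` whose Hausdorff
dimension is bounded by the dimension of the total space of the dual bundle. -/
theorem dimH_dual_values_le {m : ℕ} (s : Fin m → Cₛ^∞⟮𝓘(ℝ, E); F, V⟯) :
    dimH {c : Fin m → ℝ | ∃ (x : N) (ξ : V x →ₗ[ℝ] ℝ), ∀ i, ξ (s i x) = c i} ≤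
      (Module.finrank ℝ E + Module.finrank ℝ F : ℕ) := by
  have := FiniteDimensional.proper ℝ E
  have : SecondCountableTopology N := ChartedSpace.secondCountable_of_sigmaCompact E N
  have key (x₀ : N) : ∃ U ∈ 𝓝 x₀,
      dimH {c : Fin m → ℝ | ∃ x ∈ U, ∃ ξ : V x →ₗ[ℝ] ℝ, ∀ i, ξ (s i x) = c i} ≤
        (Module.finrank ℝ E + Module.finrank ℝ F : ℕ) := by
    set e := trivializationAt F V x₀ with he
    set φ := extChartAt 𝓘(ℝ, E) x₀ with hφ
    have hO : IsOpen (φ.target ∩ φ.symm ⁻¹' e.baseSet) :=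
      (continuousOn_extChartAt_symm x₀).isOpen_inter_preimage (isOpen_extChartAt_target x₀)
        e.open_baseSet
    have hx₀ : φ x₀ ∈ φ.target ∩ φ.symm ⁻¹' e.baseSet := by
      refine ⟨mem_extChartAt_target x₀, ?_⟩
      rw [Set.mem_preimage, hφ, extChartAt_to_inv]
      exact mem_baseSet_trivializationAt F V x₀
    obtain ⟨ε, hε, hball⟩ := Metric.isOpen_iff.1 hO _ hx₀
    refine ⟨φ.source ∩ φ ⁻¹' Metric.ball (φ x₀) ε, ?_, ?_⟩
    · exact Filter.inter_mem (extChartAt_source_mem_nhds x₀)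
        ((continuousAt_extChartAt x₀).preimage_mem_nhds (Metric.ball_mem_nhds _ hε))
    -- In coordinates the values are the image of a $C^1$ map on the convex set ball × dual of `F`.
    -- Such a map does not raise Hausdorff dimension.
    let f : E × (F →L[ℝ] ℝ) → Fin m → ℝ := fun p i => p.2 (e ⟨φ.symm p.1, s i (φ.symm p.1)⟩).2
    let t : Set (E × (F →L[ℝ] ℝ)) := Metric.ball (φ x₀) ε ×ˢ Set.univ
    have hs (i : Fin m) : ContDiffOn ℝ ∞ (fun y => (e ⟨φ.symm y, s i (φ.symm y)⟩).2)
        (Metric.ball (φ x₀) ε) := by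
      have h1 : ContMDiffOn 𝓘(ℝ, E) 𝓘(ℝ, F) ∞ (fun x => (e ⟨x, s i x⟩).2) e.baseSet :=
        e.contMDiffOn_section_baseSet_iff.1 (s i).contMDiff.contMDiffOn
      have h2 := (contMDiffOn_extChartAt_symm (I := 𝓘(ℝ, E)) (n := ∞) x₀)
      rw [← contMDiffOn_iff_contDiffOn]
      exact h1.comp (h2.mono fun y hy => (hball hy).1) fun y hy => (hball hy).2
    have hf : ContDiffOn ℝ 1 f t := by
      rw [contDiffOn_pi]
      intro i
      have h1 : ContDiffOn ℝ 1 (fun p : E × (F →L[ℝ] ℝ) =>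
          (e ⟨φ.symm p.1, s i (φ.symm p.1)⟩).2) t :=
        ((hs i).of_le (by simp)).comp contDiffOn_fst fun p hp => hp.1
      exact contDiffOn_snd.clm_apply h1
    have hle : dimH (f '' t) ≤ (Module.finrank ℝ E + Module.finrank ℝ F : ℕ) := by
      refine (hf.dimH_image_le ((convex_ball _ _).prod convex_univ) subset_rfl).trans ?_
      refine (dimH_mono (Set.subset_univ t)).trans ?_
      rw [Real.dimH_univ_eq_finrank, Module.finrank_prod,
        ← (LinearMap.toContinuousLinearMap (𝕜 := ℝ) (E := F) (F' := ℝ)).finrank_eq]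
      rw [Subspace.dual_finrank_eq]
    refine (dimH_mono ?_).trans hle
    rintro c ⟨x, ⟨hx, hx'⟩, ξ, hξ⟩
    have hxe : x ∈ e.baseSet := by
      have := (hball hx').2
      rwa [Set.mem_preimage, φ.left_inv hx] at this
    let e' := (e.continuousLinearEquivAt ℝ x hxe).toLinearEquiv
    refine ⟨(φ x, LinearMap.toContinuousLinearMap (ξ ∘ₗ e'.symm.toLinearMap)), ⟨hx', trivial⟩, ?_⟩
    ext i
    rw [← hξ i]
    change ξ (e'.symm ((e ⟨φ.symm (φ x), s i (φ.symm (φ x))⟩).2)) = ξ (s i x)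
    rw [φ.left_inv hx]
    exact congr_arg ξ (e'.symm_apply_apply (s i x))
  choose U hU hdim using key
  -- By second countability, countably many of these neighbourhoods cover `N`, and the dimension of
  -- a countable union is the supremum.
  obtain ⟨T, hT, hTU⟩ := TopologicalSpace.countable_cover_nhds hU
  have : {c : Fin m → ℝ | ∃ (x : N) (ξ : V x →ₗ[ℝ] ℝ), ∀ i, ξ (s i x) = c i} =
      ⋃ x₀ ∈ T, {c : Fin m → ℝ | ∃ x ∈ U x₀, ∃ ξ : V x →ₗ[ℝ] ℝ, ∀ i, ξ (s i x) = c i} := by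
    ext c
    simp only [Set.mem_iUnion, Set.mem_ofPred_eq]
    constructor
    · rintro ⟨x, ξ, h⟩
      obtain ⟨x₀, hx₀, hx⟩ := Set.mem_iUnion₂.1 (hTU.symm ▸ Set.mem_univ x)
      exact ⟨x₀, hx₀, x, hx, ξ, h⟩
    · rintro ⟨-, -, x, -, ξ, h⟩
      exact ⟨x, ξ, h⟩
  rw [this, dimH_bUnion hT]
  exact iSup₂_le fun x _ => hdim x

/-- A spanning family of more sections than the dimension of the total space of the bundle can be
replaced by one with one section less. -/
theorem exists_spansOn_pred {m : ℕ} (hm : Module.finrank ℝ E + Module.finrank ℝ F < m + 1)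
    (s : Fin (m + 1) → Cₛ^∞⟮𝓘(ℝ, E); F, V⟯) {K : Set N} (hs : SpansOn V s K) :
    ∃ t : Fin m → Cₛ^∞⟮𝓘(ℝ, E); F, V⟯, SpansOn V t K := by
  have hdense := dense_compl_of_dimH_lt_finrank ((dimH_dual_values_le s).trans_lt (by
    rw [Module.finrank_fin_fun]
    exact_mod_cast hm))
  -- The value vectors have dimension below `m + 1`, so their complement is dense. Projecting along
  -- a direction `c` that no linear form realizes loses no spanning.
  obtain ⟨c, hcl, hc⟩ := hdense.inter_open_nonempty {c | c (Fin.last m) ≠ 0}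
    (isOpen_ne_fun (continuous_apply _) continuous_const) ⟨fun _ => 1, one_ne_zero⟩
  refine ⟨fun j => s j.castSucc - (c j.castSucc / c (Fin.last m)) • s (Fin.last m),
    fun x hx ξ hξ => ?_⟩
  have h1 (j : Fin m) : ξ (s j.castSucc x) =
      c j.castSucc / c (Fin.last m) * ξ (s (Fin.last m) x) := by
    have : ξ (s j.castSucc x - (c j.castSucc / c (Fin.last m)) • s (Fin.last m) x) = 0 := hξ j
    rwa [map_sub, map_smul, sub_eq_zero, smul_eq_mul] at this
  by_cases h0 : ξ (s (Fin.last m) x) = 0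
  · refine hs x hx ξ fun i => ?_
    induction i using Fin.lastCases with
    | last => exact h0
    | cast j => rw [h1, h0, mul_zero]
  -- The values of `ξ` are proportional to `c`; this rescaling would realize `c` itself.
  · refine (hc ⟨x, (c (Fin.last m) / ξ (s (Fin.last m) x)) • ξ, fun i => ?_⟩).elim
    rw [LinearMap.smul_apply, smul_eq_mul]
    have hcl' : c (Fin.last m) ≠ 0 := hcl
    induction i using Fin.lastCases with
    | last => field_simp
    | cast j => rw [h1]; field_simp

/-- The point is that the number does not depend on `K`: this lets the sections on different shells
be summed index by index. Shorter families are padded with zero. -/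
theorem exists_spansOn_finrank_add {K : Set N} (hK : IsCompact K) :
    ∃ s : Fin (Module.finrank ℝ E + Module.finrank ℝ F) → Cₛ^∞⟮𝓘(ℝ, E); F, V⟯, SpansOn V s K := by
  obtain ⟨m, s, hs⟩ := exists_spansOn_of_isCompact (E := E) (F := F) (V := V) hK
  induction m with
  | zero => exact ⟨fun _ => 0, fun x hx ξ _ => hs x hx ξ fun i => i.elim0⟩
  | succ m ih =>
    by_cases hm : Module.finrank ℝ E + Module.finrank ℝ F < m + 1
    · obtain ⟨t, ht⟩ := exists_spansOn_pred hm s hs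
      exact ih t ht
    · have hm' : m + 1 ≤ Module.finrank ℝ E + Module.finrank ℝ F := not_lt.1 hm
      refine ⟨fun j => if h : (j : ℕ) < m + 1 then s ⟨j, h⟩ else 0, fun x hx ξ hξ =>
        hs x hx ξ fun i => ?_⟩
      have := hξ (i.castLE hm')
      simp only [Fin.val_castLE, i.2, dif_pos] at this
      exact this

/-- A vector bundle of finite rank over a finite-dimensional manifold has finitely many global
sections spanning every fibre. -/
theorem exists_spansOn_univ :
    ∃ (m : ℕ) (s : Fin m → Cₛ^∞⟮𝓘(ℝ, E); F, V⟯), SpansOn V s Set.univ := by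
  have := Manifold.locallyCompact_of_finiteDimensional (M := N) 𝓘(ℝ, E)
  let C := (CompactExhaustion.choice N)
  -- The shift makes `K 0` empty, so that the shells start from nothing and the truncated `p - 1` at
  -- `p = 0` is harmless.
  let K := C.shiftr
  have hK0 : K 0 = ∅ := rfl
  have hmono {p q : ℕ} (h : p ≤ q) : K p ⊆ K q := K.subset h
  have hShell (p : ℕ) : IsCompact (K (p + 1) \ interior (K p)) :=
    (K.isCompact _).diff isOpen_interior
  choose s hs using fun p => exists_spansOn_finrank_add (E := E) (F := F) (V := V) (hShell p)
  -- The cutoff for shell `p` is nonzero only inside `interior (K (p + 2)) \ K (p - 1)`. For indices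
  -- differing by at least three these sets are disjoint.
  have hcut (p : ℕ) : ∃ f : C^∞⟮𝓘(ℝ, E), N; 𝓘(ℝ), ℝ⟯,
      Set.EqOn f 0 ((interior (K (p + 2)))ᶜ ∪ K (p - 1)) ∧
      Set.EqOn f 1 (K (p + 1) \ interior (K p)) := by
    obtain ⟨f, h0, h1, -⟩ := exists_contMDiffMap_zero_one_of_isClosed 𝓘(ℝ, E) (n := ⊤)
      (isOpen_interior.isClosed_compl.union (K.isClosed (p - 1))) (hShell p).isClosed (by
        refine Set.disjoint_left.2 fun x hx hx' => ?_
        rcases hx with hx | hx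
        · exact hx (K.subset_interior_succ _ hx'.1)
        · refine hx'.2 ?_
          rcases p with _ | p
          · exact absurd hx (by rw [Nat.zero_sub, hK0]; exact id)
          · exact K.subset_interior_succ _ hx)
    exact ⟨f, h0, h1⟩
  choose χ hχ0 hχ1 using hcut
  have hfin (c j) : LocallyFinite fun q : ℕ =>
      {x : N | (χ (3 * q + c) • s (3 * q + c) j) x ≠ 0} := by
    intro x
    obtain ⟨p, hp⟩ := K.exists_mem x
    refine ⟨K (p + 1), mem_interior_iff_mem_nhds.1 (K.subset_interior_succ _ hp),
      (Set.finite_Iic (p + 2)).subset ?_⟩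
    rintro q ⟨y, hy, hyK⟩
    by_contra hq
    rw [Set.mem_Iic, not_le] at hq
    refine hy ?_
    rw [smul_section_apply, hχ0 _ (Or.inr (hmono (by omega) hyK)), Pi.zero_apply, zero_smul]
  -- One section for each residue class modulo 3 and each index `j`. On shell `p` only the term of
  -- index `p` in its own class survives, and there it equals `s p j`.
  let t (c : Fin 3) (j : Fin (Module.finrank ℝ E + Module.finrank ℝ F)) :
      Cₛ^∞⟮𝓘(ℝ, E); F, V⟯ :=
    ⟨fun x => ∑ᶠ q : ℕ, (χ (3 * q + c) • s (3 * q + c) j) x,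
      ContMDiff.finsum_section_of_locallyFinite (hfin c j) fun q =>
        (χ (3 * q + c) • s (3 * q + c) j).contMDiff⟩
  refine ⟨_, fun i => t (finProdFinEquiv.symm i).1 (finProdFinEquiv.symm i).2,
    fun x _ ξ hξ => ?_⟩
  obtain ⟨hx, hx'⟩ := C.mem_sdiff_shiftr_find x
  set p := C.find x
  have hxS : x ∈ K (p + 1) \ interior (K p) := ⟨hx, fun h => hx' (interior_subset h)⟩
  refine hs p x hxS ξ fun j => ?_
  have h := hξ (finProdFinEquiv (⟨p % 3, Nat.mod_lt _ (by norm_num)⟩, j))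
  simp only [Equiv.symm_apply_apply] at h
  have hp : 3 * (p / 3) + p % 3 = p := Nat.div_add_mod p 3
  have ht : t ⟨p % 3, Nat.mod_lt _ (by norm_num)⟩ j x = s p j x := by
    change ∑ᶠ q : ℕ, (χ (3 * q + p % 3) • s (3 * q + p % 3) j) x = _
    rw [finsum_eq_single _ (p / 3), hp, smul_section_apply, hχ1 p hxS, Pi.one_apply, one_smul]
    intro q hq
    rw [smul_section_apply, hχ0, Pi.zero_apply, zero_smul]
    rcases lt_or_gt_of_ne hq with hlt | hlt
    · left
      intro h
      exact hx' (hmono (by omega) (interior_subset h))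
    · right
      exact hmono (by omega) hx
  rwa [ht] at h

/-- Finitely many global sections of a vector bundle together with dual sections. -/
theorem exists_finite_dual_frame :
    ∃ (m : ℕ) (e : Fin m → Cₛ^∞⟮𝓘(ℝ, E); F, V⟯)
      (σ : ∀ x, V x →L[ℝ] Bundle.Trivial N (Fin m → ℝ) x),
      ContMDiff 𝓘(ℝ, E) (𝓘(ℝ, E).prod 𝓘(ℝ, F →L[ℝ] (Fin m → ℝ))) ∞
        (fun x => TotalSpace.mk' (F →L[ℝ] (Fin m → ℝ))
          (E := fun x => V x →L[ℝ] Bundle.Trivial N (Fin m → ℝ) x) x (σ x)) ∧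
      ∀ x v, ∑ j, (show Fin m → ℝ from σ x v) j • e j x = v := by
  have := isTopologicalAddGroup_fibre F V
  have := continuousSMul_fibre F V
  have := t2Space_fibre F V
  have := finiteDimensional_fibre F V
  obtain ⟨m, e, he⟩ := exists_spansOn_univ (E := E) (F := F) (V := V)
  let ρ₀ (x : N) : Bundle.Trivial N (Fin m → ℝ) x →ₗ[ℝ] V x := Fintype.linearCombination ℝ (e · x)
  -- A proper subspace would lie in the kernel of a nonzero linear form, which would vanish on every
  -- `e i x`.
  have hsurj (x : N) : LinearMap.range (ρ₀ x) = ⊤ := by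
    by_contra h
    obtain ⟨ξ, hξ, hle⟩ := Submodule.exists_le_ker_of_lt_top _ (lt_top_iff_ne_top.2 h)
    refine hξ (he x trivial ξ fun i => hle ⟨Pi.single i (1 : ℝ), ?_⟩)
    exact (Fintype.linearCombination_apply_single ℝ (e · x) i 1).trans (one_smul _ _)
  let ρ (x : N) : Bundle.Trivial N (Fin m → ℝ) x →L[ℝ] V x :=
    LinearMap.toContinuousLinearMap (E := Fin m → ℝ) (ρ₀ x)
  have hρ : ContMDiff 𝓘(ℝ, E) (𝓘(ℝ, E).prod 𝓘(ℝ, (Fin m → ℝ) →L[ℝ] F)) ∞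
      (fun x => TotalSpace.mk' ((Fin m → ℝ) →L[ℝ] F)
        (E := fun x => Bundle.Trivial N (Fin m → ℝ) x →L[ℝ] V x) x (ρ x)) := by
    intro x
    refine contMDiffAt_hom_of_symm fun v => ?_
    have h : ContMDiff 𝓘(ℝ, E) (𝓘(ℝ, E).prod 𝓘(ℝ, F)) ∞
        (fun x => TotalSpace.mk' F x (∑ j, v j • e j x)) :=
      ContMDiff.sum_section fun j _ => (e j).contMDiff.const_smul_section
    convert! h x using 1
    funext y
    rw [show (trivializationAt (Fin m → ℝ) (Bundle.Trivial N (Fin m → ℝ)) x).symm y v = v by simp]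
    rfl
  obtain ⟨σ, hσ⟩ := exists_contMDiffSection_generalized_inverse ρ hρ (Module.finrank ℝ F) (by
    intro x
    have : LinearMap.range (ρ x).toLinearMap = ⊤ := hsurj x
    rw [this, finrank_top]
    exact ((trivializationAt F V x).continuousLinearEquivAt ℝ x
      (mem_baseSet_trivializationAt F V x)).toLinearEquiv.finrank_eq)
  refine ⟨m, e, σ, σ.contMDiff, fun x v => ?_⟩
  -- For surjective `ρ`, the identity `ρ σ ρ = ρ` says `ρ σ = 1`.
  obtain ⟨c, rfl⟩ := (hsurj x).ge (Submodule.mem_top (x := v))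
  exact hσ x c

end Frames

end LieAlgebroidTheory

/-! ### Casimir elements, and the bracket described by a connection -/

namespace LieRinehartAlgebra

variable {R A L M : Type*} [CommRing R] [CommRing A] [Algebra R A]
  [LieRing L] [LieAlgebra R L] [Module A L] [LieRingModule L A] [LieRinehartRing A L]
  [LieRinehartAlgebra R A L]

theorem tautological_algebraMap_ι (a : A) (x : L) :
    (tautological R A L).br (algebraMap A _ a) (SymmetricAlgebra.ι A L x) =
      - algebraMap A _ ⁅x, a⁆ := by
  have h := (tautological R A L).br_self (algebraMap A _ a + SymmetricAlgebra.ι A L x)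
  simp only [map_add, LinearMap.add_apply, PoissonBracket.br_self, zero_add, add_zero,
    tautological_ι_algebraMap] at h
  exact eq_neg_of_add_eq_zero_right h

/-- A function annihilated by the whole Lie-Rinehart algebra is a Casimir element of the
tautological Poisson algebra. -/
theorem isCasimir_tautological_algebraMap {a : A} (h : ∀ x : L, ⁅x, a⁆ = 0) :
    (tautological R A L).IsCasimir (algebraMap A _ a) := by
  intro u
  induction u using SymmetricAlgebra.induction with
  | algebraMap b => exact tautological_algebraMap_algebraMap R A L a b
  | ι x => rw [tautological_algebraMap_ι, h, map_zero, neg_zero]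
  | mul u v hu hv => rw [PoissonBracket.leibniz, hu, hv, zero_mul, mul_zero, add_zero]
  | add u v hu hv => rw [map_add, hu, hv, add_zero]

variable [LieRing M] [LieAlgebra R M] [Module A M] [LieRingModule M A] [LieRinehartRing A M]
  [LieRinehartAlgebra R A M]

theorem _root_.PoissonBracket.br_skew {R S : Type*} [CommRing R] [CommRing S] [Algebra R S]
    (P : PoissonBracket R S) (u v : S) : P.br u v = - P.br v u := by
  have h := P.br_self (u + v)
  simp only [map_add, LinearMap.add_apply, P.br_self, zero_add, add_zero] at h
  exact eq_neg_of_add_eq_zero_right h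

theorem Connection.exists_add_ker {p : Hom (AlgHom.id R A) L M} (w : Connection p) (x : L) :
    ∃ y : p.kernel, x = w (p x) + y := by
  refine ⟨⟨x - w (p x), ?_⟩, by simp⟩
  change p.toLieHom (x - w (p x)) = 0
  rw [map_sub]
  exact sub_eq_zero.2 (w.section_apply (p x)).symm

/-- The action of `L` on `A` factors through `p`. -/
theorem kernel_lie_apply {p : Hom (AlgHom.id R A) L M} (x : p.kernel) (a : A) :
    ⁅(x : L), a⁆ = 0 := by
  have h := p.apply_lie a (x : L)
  rw [show p (x : L) = 0 from x.2, zero_lie] at h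
  exact h

/-- The tautological bracket is the only Poisson bracket described by a given connection. -/
theorem Connection.describes_iff {p : Hom (AlgHom.id R A) L M} (w : Connection p)
    (P : PoissonBracket R (SymmetricAlgebra A L)) :
    w.Describes P ↔ P = tautological R A L := by
  constructor
  · intro h
    have hfun (x : L) (a : A) :
        P.br (SymmetricAlgebra.ι A L x) (algebraMap A _ a) = algebraMap A _ ⁅x, a⁆ := by
      obtain ⟨y, hy⟩ := w.exists_add_ker x
      rw [hy, map_add, map_add, LinearMap.add_apply, h.base_fun, h.ker_fun, add_lie,
        w.lie_apply, kernel_lie_apply, add_zero, add_zero]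
    refine tautological_unique R A L P h.fun_fun hfun fun x y => ?_
    obtain ⟨x', hx⟩ := w.exists_add_ker x
    obtain ⟨y', hy⟩ := w.exists_add_ker y
    rw [hx, hy]
    simp only [map_add, LinearMap.add_apply, h.base_base, h.base_ker, h.ker_ker, add_lie, lie_add]
    -- The mixed bracket in the other order follows by skewness, and the curvature term corrects `ω
    -- [x, y]` to `[ω x, ω y]`.
    rw [P.br_skew (SymmetricAlgebra.ι A L x'), h.base_ker, w.curvature_apply,
      ← lie_skew (x' : L) (w _)]
    simp only [map_neg, map_sub]
    rw [show ((⁅x', y'⁆ : p.kernel) : L) = ⁅(x' : L), (y' : L)⁆ from rfl]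
    abel
  · rintro rfl
    refine ⟨fun x y => ?_, fun x y => ?_, fun x y => ?_, fun x a => ?_, fun x a => ?_, ?_⟩
    · exact tautological_ι_ι R A L _ _
    · rw [tautological_ι_ι, w.curvature_apply, ← map_add, add_sub_cancel]
    · exact tautological_ι_ι R A L _ _
    · rw [tautological_ι_algebraMap, w.lie_apply]
    · rw [tautological_ι_algebraMap, kernel_lie_apply, map_zero]
    · exact tautological_algebraMap_algebraMap R A L

end LieRinehartAlgebra

namespace LieAlgebroidTheory

open scoped ContDiff

/-! ### Functions constant on leaves and integral curves -/

section Curves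

variable {E : Type*} [NormedAddCommGroup E] [NormedSpace ℝ E]
  {N : Type*} [TopologicalSpace N] [ChartedSpace E N] [IsManifold 𝓘(ℝ, E) ∞ N]

/-- Integral curves of a smooth vector field are continuously differentiable. -/
theorem eventually_contMDiffAt_of_isMIntegralCurveAt (X : VectorFields E N) {γ : ℝ → N} {t₀ : ℝ}
    (hγ : IsMIntegralCurveAt γ X t₀) :
    ∀ᶠ t in 𝓝 t₀, ContMDiffAt 𝓘(ℝ, ℝ) 𝓘(ℝ, E) 1 γ t := by
  have : IsManifold 𝓘(ℝ, E) 1 N := IsManifold.of_le (n := ∞) (by simp)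
  set e := trivializationAt E (TangentSpace 𝓘(ℝ, E) : N → Type _) (γ t₀)
  have hsrc : ∀ᶠ t in 𝓝 t₀, γ t ∈ (extChartAt 𝓘(ℝ, E) (γ t₀)).source :=
    hγ.continuousAt.preimage_mem_nhds (extChartAt_source_mem_nhds _)
  filter_upwards [hγ.eventually_hasDerivAt.eventually_nhds, hγ.eventually_nhds,
    hsrc.eventually_nhds] with t h1 h2 h3
  rw [contMDiffAt_iff_target_of_mem_source
    (by simpa using h3.self_of_nhds : γ t ∈ (chartAt E (γ t₀)).source)]
  refine ⟨h2.self_of_nhds.continuousAt, ?_⟩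
  rw [contMDiffAt_iff_contDiffAt, contDiffAt_one_iff]
  -- In the fixed chart at `γ t₀` the velocity is the coordinate expression of `X` along `γ`, which
  -- is continuous because `γ` and `X` are.
  refine ⟨fun s => (1 : ℝ →L[ℝ] ℝ).smulRight (e ⟨γ s, X (γ s)⟩).2,
    {s | γ s ∈ (extChartAt 𝓘(ℝ, E) (γ t₀)).source ∧ ContinuousAt γ s ∧
      HasDerivAt (extChartAt 𝓘(ℝ, E) (γ t₀) ∘ γ)
        (tangentCoordChange 𝓘(ℝ, E) (γ s) (γ t₀) (γ s) (X (γ s))) s}, ?_, ?_, ?_⟩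
  · filter_upwards [h1, h2, h3] with s hs1 hs2 hs3
    exact ⟨hs3, hs2.continuousAt, hs1⟩
  · rintro s ⟨hs1, hs2, -⟩
    refine ContinuousAt.continuousWithinAt ?_
    have hX : ContinuousAt (fun s => (e ⟨γ s, X (γ s)⟩).2) s := by
      have h1 : ContinuousAt (fun s => TotalSpace.mk' E (E := TangentSpace 𝓘(ℝ, E)) (γ s)
          (X (γ s))) s := X.contMDiff.continuous.continuousAt.comp hs2
      have h2 : ContinuousAt e (TotalSpace.mk' E (E := TangentSpace 𝓘(ℝ, E)) (γ s) (X (γ s))) :=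
        e.continuousAt (by
          rw [e.mem_source]
          simpa [e] using hs1)
      exact (ContinuousAt.comp (f := fun s => TotalSpace.mk' E (E := TangentSpace 𝓘(ℝ, E)) (γ s)
          (X (γ s))) h2 h1).snd
    exact (ContinuousLinearMap.smulRightL ℝ ℝ E (1 : ℝ →L[ℝ] ℝ)).continuous.continuousAt.comp hX
  · rintro s ⟨-, -, hs⟩
    exact hs.hasFDerivAt

/-- A smooth function which is constant on the leaves of `D` is annihilated by the vector fields
tangent to `D`. -/
theorem deriv_eq_zero_of_mem_leafConstants [CompleteSpace E]
    {D : ∀ x : N, Submodule ℝ (TangentSpace 𝓘(ℝ, E) x)}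
    {f : SmoothFunctions E N} (hf : f ∈ leafConstants D) (X : VectorFields E N)
    (hX : ∀ x, X x ∈ D x) : X.deriv f = 0 := by
  have : IsManifold 𝓘(ℝ, E) 1 N := IsManifold.of_le (n := ∞) (by simp)
  ext x
  obtain ⟨γ, hγ0, hγ⟩ := exists_isMIntegralCurveAt_of_contMDiffAt_boundaryless (I := 𝓘(ℝ, E)) 0
    ((X.contMDiff x).of_le (by simp) : ContMDiffAt _ _ 1 _ _)
  obtain ⟨ε, hε, hball⟩ := Metric.eventually_nhds_iff_ball.1
    (Filter.Eventually.and hγ (eventually_contMDiffAt_of_isMIntegralCurveAt X hγ))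
  -- `SameLeaf` asks for curves on all of `ℝ`, while the integral curve is controlled only on a
  -- ball. Reparametrizing by $\frac{\varepsilon}{2}\sin$ keeps the parameter in the ball for all
  -- times.
  have hφ (t : ℝ) : ε / 2 * Real.sin t ∈ Metric.ball (0 : ℝ) ε := by
    rw [mem_ball_zero_iff, Real.norm_eq_abs, abs_mul, abs_of_pos (half_pos hε)]
    nlinarith [Real.abs_sin_le_one t]
  have hc (s : ℝ) (t : ℝ) : HasMFDerivAt 𝓘(ℝ, ℝ) 𝓘(ℝ, E)
      (fun t => γ (ε / 2 * Real.sin (s * t))) t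
      (((1 : ℝ →L[ℝ] ℝ).smulRight (X (γ (ε / 2 * Real.sin (s * t))))) ∘L
        ((1 : ℝ →L[ℝ] ℝ).smulRight (ε / 2 * (Real.cos (s * t) * s)))) := by
    have h1 : HasDerivAt (fun t => ε / 2 * Real.sin (s * t)) (ε / 2 * (Real.cos (s * t) * s)) t :=
      (((hasDerivAt_id t).const_mul s).sin.const_mul (ε / 2)).congr_deriv (by simp)
    exact HasMFDerivAt.comp t (hball _ (hφ _)).1 h1.hasFDerivAt.hasMFDerivAt
  -- The curve with frequency `s` runs from `x` at time 0 to the required point at time 1. Its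
  -- velocity is a multiple of `X`, so it is tangent to `D`.
  have hconst (s : ℝ) : f (γ (ε / 2 * Real.sin s)) = f x := by
    refine (hf _ _ (Relation.EqvGen.rel _ _ ⟨fun t => γ (ε / 2 * Real.sin (s * t)), ?_, ?_, ?_,
      ?_⟩)).symm
    · intro t
      have h1 : ContMDiffAt 𝓘(ℝ, ℝ) 𝓘(ℝ, ℝ) 1 (fun t => ε / 2 * Real.sin (s * t)) t :=
        ContDiff.contMDiff (by fun_prop) t
      exact ContMDiffAt.comp t (hball _ (hφ _)).2 h1
    · simpa using hγ0
    · simp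
    · intro t
      rw [(hc s t).mfderiv]
      have : (((1 : ℝ →L[ℝ] ℝ).smulRight (X (γ (ε / 2 * Real.sin (s * t))))) ∘L
          ((1 : ℝ →L[ℝ] ℝ).smulRight (ε / 2 * (Real.cos (s * t) * s)))) (1 : ℝ) =
          (ε / 2 * (Real.cos (s * t) * s)) • X (γ (ε / 2 * Real.sin (s * t))) := by
        simp
      exact Eq.mpr (congr_arg (fun v => v ∈ D (γ (ε / 2 * Real.sin (s * t)))) this)
        (Submodule.smul_mem _ _ (hX _))
  -- At time 0 and frequency 1 the velocity is $\frac{\varepsilon}{2}X_x$ with $\varepsilon\neq0$,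
  -- so constancy of `f` along this curve gives $X_x(f)=0$.
  have h0 := hc 1 0
  have hfx : MDifferentiableAt 𝓘(ℝ, E) 𝓘(ℝ, ℝ) f (γ (ε / 2 * Real.sin (1 * 0))) :=
    f.contMDiff.mdifferentiable (by simp) _
  have h1 := HasMFDerivAt.comp (0 : ℝ) hfx.hasMFDerivAt h0
  have h2 : HasMFDerivAt 𝓘(ℝ, ℝ) 𝓘(ℝ, ℝ) (f ∘ fun t => γ (ε / 2 * Real.sin (1 * t))) (0 : ℝ)
      (0 : ℝ →L[ℝ] ℝ) := by
    have : (f ∘ fun t => γ (ε / 2 * Real.sin (1 * t))) = fun _ => f x := by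
      ext t
      exact hconst _
    rw [this]
    exact hasMFDerivAt_const _ _
  have h3 : mfderiv 𝓘(ℝ, E) 𝓘(ℝ, ℝ) f (γ (ε / 2 * Real.sin (1 * 0)))
      (((1 : ℝ) * (ε / 2 * (Real.cos (1 * 0) * 1))) • X (γ (ε / 2 * Real.sin (1 * 0)))) = 0 :=
    congr($(hasMFDerivAt_unique h1 h2) (1 : ℝ))
  have hx : γ (ε / 2 * Real.sin (1 * 0)) = x := by simpa using hγ0
  rw [hx, map_smul] at h3
  exact (smul_eq_zero.1 h3).resolve_left (by simp [hε.ne'])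

end Curves

end LieAlgebroidTheory

namespace LieAlgebroidTheory

open scoped ContDiff

/-! ### The foliation, the image of the anchor and connections -/

namespace LieAlgebroid

variable {E : Type*} [NormedAddCommGroup E] [NormedSpace ℝ E] [FiniteDimensional ℝ E]
  {N : Type*} [TopologicalSpace N] [T2Space N] [SigmaCompactSpace N]
  [ChartedSpace E N] [IsManifold 𝓘(ℝ, E) ∞ N]
  {F : Type*} [NormedAddCommGroup F] [NormedSpace ℝ F] [FiniteDimensional ℝ F]
  {V : N → Type*} [TopologicalSpace (TotalSpace F V)] [∀ x, TopologicalSpace (V x)]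
  [FiberBundle F V] [∀ x, AddCommGroup (V x)] [∀ x, Module ℝ (V x)] [VectorBundle ℝ F V]
  [ContMDiffVectorBundle ∞ F V 𝓘(ℝ, E)]
  (𝓛 : LieAlgebroid E F V)

/-- If the anchor has constant rank, it has a generalized inverse on the level of sections. -/
theorem exists_section_of_anchorMap {r : ℕ}
    (hr : ∀ x, Module.finrank ℝ (LinearMap.range (𝓛.anchor.toFun x)) = r) :
    ∃ σ : VectorFields E N →ₗ[SmoothFunctions E N] 𝓛.Sections,
      ∀ X : VectorFields E N, (∀ x, X x ∈ 𝓛.distribution x) → 𝓛.anchorMap (σ X) = X := by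
  have := isTopologicalAddGroup_fibre F V
  have := continuousSMul_fibre F V
  have := t2Space_fibre F V
  have := finiteDimensional_fibre F V
  have : IsManifold 𝓘(ℝ, E) (∞ + 1) N := by simpa using! ‹IsManifold 𝓘(ℝ, E) ∞ N›
  let ρ (x : N) : V x →L[ℝ] TangentSpace 𝓘(ℝ, E) x :=
    LinearMap.toContinuousLinearMap (𝓛.anchor.toFun x)
  have hρ : ContMDiff 𝓘(ℝ, E) (𝓘(ℝ, E).prod 𝓘(ℝ, F →L[ℝ] E)) ∞
      (fun x => TotalSpace.mk' (F →L[ℝ] E) (E := fun x => V x →L[ℝ] TangentSpace 𝓘(ℝ, E) x)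
        x (ρ x)) := fun x =>
    contMDiffAt_hom_of_symm fun v =>
      𝓛.anchor.contMDiff.contMDiffAt.comp x (contMDiffAt_symm_section (E := E) x v)
  obtain ⟨σ, hσ⟩ := exists_contMDiffSection_generalized_inverse ρ hρ r hr
  let τ : VectorFields E N →ₗ[SmoothFunctions E N] Cₛ^∞⟮𝓘(ℝ, E); F, V⟯ :=
    { toFun := fun X => ⟨fun x => σ x (X x), σ.contMDiff.clm_bundle_apply X.contMDiff⟩
      map_add' := fun X Y => ContMDiffSection.ext fun x => (σ x).map_add (X x) (Y x)
      map_smul' := fun f X => ContMDiffSection.ext fun x => (σ x).map_smul (f x) (X x) }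
  refine ⟨𝓛.sectionsEquiv.symm.toLinearMap ∘ₗ τ, fun X hX => ContMDiffSection.ext fun x => ?_⟩
  obtain ⟨v, hv⟩ := hX x
  change ρ x (σ x (X x)) = X x
  rw [← hv]
  exact hσ x v

theorem mem_image_anchorHom_iff {r : ℕ}
    (hr : ∀ x, Module.finrank ℝ (LinearMap.range (𝓛.anchor.toFun x)) = r)
    (X : VectorFields E N) : X ∈ 𝓛.anchorHom.image ↔ ∀ x, X x ∈ 𝓛.distribution x := by
  constructor
  · rintro ⟨s, rfl⟩ x
    exact ⟨𝓛.value s x, rfl⟩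
  · intro hX
    obtain ⟨σ, hσ⟩ := 𝓛.exists_section_of_anchorMap hr
    exact ⟨σ X, hσ X hX⟩

/-- Vectors in the image extend because vectors of the bundle extend to sections. Involutivity holds
since tangent fields are exactly the image of `L`, which is closed under brackets. -/
theorem isFoliation_distribution {r : ℕ}
    (hr : ∀ x, Module.finrank ℝ (LinearMap.range (𝓛.anchor.toFun x)) = r) :
    IsFoliation 𝓛.distribution where
  rank := ⟨r, hr⟩
  smooth := by
    rintro x _ ⟨v, rfl⟩
    obtain ⟨s, hs⟩ := exists_contMDiffSection_apply_eq (E := E) (F := F) x v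
    refine ⟨𝓛.anchor.onSections s, fun y => ⟨s y, rfl⟩, ?_⟩
    change 𝓛.anchor.toFun x (s x) = _
    rw [hs]
  involutive := by
    intro X Y hX hY
    rw [← 𝓛.mem_image_anchorHom_iff hr] at hX hY ⊢
    exact 𝓛.anchorHom.image.lie_mem hX hY

theorem nonempty_connection {r : ℕ}
    (hr : ∀ x, Module.finrank ℝ (LinearMap.range (𝓛.anchor.toFun x)) = r) :
    Nonempty (Connection 𝓛.anchorHom.toImage) := by
  obtain ⟨σ, hσ⟩ := 𝓛.exists_section_of_anchorMap hr
  exact ⟨{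
    toLinearMap :=
      { toFun := fun X => σ X
        map_add' := fun X Y => σ.map_add X Y
        map_smul' := fun f X => σ.map_smul f X }
    section_apply := fun X =>
      Subtype.ext (hσ X ((𝓛.mem_image_anchorHom_iff hr X).1 X.2)) }⟩

theorem isCasimir_of_mem_leafConstants {f : SmoothFunctions E N}
    (hf : f ∈ leafConstants 𝓛.distribution) :
    (tautological ℝ (SmoothFunctions E N) 𝓛.Sections).IsCasimir (algebraMap _ _ f) ∧
      (tautological ℝ (SmoothFunctions E N) 𝓛.anchorHom.image).IsCasimir (algebraMap _ _ f) := by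
  have := FiniteDimensional.complete ℝ E
  have h (s : 𝓛.Sections) : (𝓛.anchorMap s).deriv f = 0 :=
    deriv_eq_zero_of_mem_leafConstants hf _ fun x => ⟨𝓛.value s x, rfl⟩
  refine ⟨isCasimir_tautological_algebraMap h, isCasimir_tautological_algebraMap ?_⟩
  rintro ⟨_, s, rfl⟩
  exact h s

end LieAlgebroid

end LieAlgebroidTheory

/-! ### Real polynomials of bounded degree -/

namespace MvPolynomial

/-- Substitution of polynomials of degree at most one does not increase the total degree. -/
theorem totalDegree_aeval_le_of_totalDegree_le_one {R σ τ : Type*} [CommRing R]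
    (p : MvPolynomial σ R) (q : σ → MvPolynomial τ R) (hq : ∀ i, (q i).totalDegree ≤ 1) :
    (aeval q p).totalDegree ≤ p.totalDegree := by
  rw [aeval_def, eval₂_eq]
  refine (totalDegree_finsetSum _ _).trans (Finset.sup_le fun α hα => ?_)
  refine (totalDegree_mul _ _).trans ?_
  rw [algebraMap_eq, totalDegree_C, zero_add]
  refine (totalDegree_finsetProd _ _).trans ((Finset.sum_le_sum fun i _ => ?_).trans
    (le_totalDegree hα))
  exact (totalDegree_pow _ _).trans ((Nat.mul_le_mul_left _ (hq i)).trans (mul_one _).le)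

/-- Over an infinite field, linear forms on the space of polynomials of bounded degree are linear
combinations of evaluations. -/
theorem span_eval_restrictTotalDegree {K σ : Type*} [Field K] [Infinite K] [Finite σ] (d : ℕ) :
    Submodule.span K (Set.range fun η : σ → K =>
      (aeval (R := K) η).toLinearMap ∘ₗ (restrictTotalDegree σ K d).subtype) = ⊤ := by
  by_contra h
  obtain ⟨φ, hφ, hle⟩ := Submodule.exists_le_ker_of_lt_top _ (lt_top_iff_ne_top.2 h)
  -- By reflexivity of the finite-dimensional space, a functional on its dual killing all
  -- evaluations is given by a polynomial vanishing at every point, which is zero over an infinite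
  -- field.
  obtain ⟨w, rfl⟩ := (Module.evalEquiv K (restrictTotalDegree σ K d)).surjective φ
  refine hφ ?_
  have hw : w = 0 := by
    refine Subtype.ext (funext fun η => ?_)
    rw [← coe_aeval_eq_eval η]
    have := hle (Submodule.subset_span ⟨η, rfl⟩)
    simpa using this
  rw [hw, map_zero]

end MvPolynomial

namespace LieAlgebroidTheory

open scoped ContDiff

/-! ### Smooth maps into trivial bundles -/

section TrivialBundle

variable {E : Type*} [NormedAddCommGroup E] [NormedSpace ℝ E]
  {N : Type*} [TopologicalSpace N] [ChartedSpace E N]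
  {E' : Type*} [NormedAddCommGroup E'] [NormedSpace ℝ E'] {H' : Type*} [TopologicalSpace H']
  {I' : ModelWithCorners ℝ E' H'} {M : Type*} [TopologicalSpace M] [ChartedSpace H' M]
  {G : Type*} [NormedAddCommGroup G] [NormedSpace ℝ G]

theorem contMDiff_trivial_mk_iff {n : WithTop ℕ∞} {b : M → N}
    (hb : ContMDiff I' 𝓘(ℝ, E) n b) {f : M → G} :
    ContMDiff I' (𝓘(ℝ, E).prod 𝓘(ℝ, G)) n
      (fun m => TotalSpace.mk' G (E := Bundle.Trivial N G) (b m) (f m)) ↔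
    ContMDiff I' 𝓘(ℝ, G) n f :=
  ⟨fun h x => (contMDiffAt_totalSpace.1 (h x)).2, fun h x => contMDiffAt_totalSpace.2 ⟨hb x, h x⟩⟩

end TrivialBundle

/-! ### The symmetric algebra as functions on the dual bundle -/

namespace LieAlgebroid

variable {E : Type*} [NormedAddCommGroup E] [NormedSpace ℝ E] [FiniteDimensional ℝ E]
  {N : Type*} [TopologicalSpace N] [ChartedSpace E N] [IsManifold 𝓘(ℝ, E) ∞ N]
  {F : Type*} [NormedAddCommGroup F] [NormedSpace ℝ F]
  {V : N → Type*} [TopologicalSpace (TotalSpace F V)] [∀ x, TopologicalSpace (V x)]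
  [FiberBundle F V] [∀ x, AddCommGroup (V x)] [∀ x, Module ℝ (V x)] [VectorBundle ℝ F V]
  [ContMDiffVectorBundle ∞ F V 𝓘(ℝ, E)]
  (𝓛 : LieAlgebroid E F V)

theorem contMDiff_eval_section (s : 𝓛.Sections) :
    ContMDiff (𝓘(ℝ, E).prod 𝓘(ℝ, F →L[ℝ] ℝ)) 𝓘(ℝ, ℝ) ∞
      (fun ξ : 𝓛.DualSpace => (ξ.2 (𝓛.value s ξ.1) : ℝ)) := by
  have hb : ContMDiff (𝓘(ℝ, E).prod 𝓘(ℝ, F →L[ℝ] ℝ)) 𝓘(ℝ, E) ∞ (fun ξ : 𝓛.DualSpace => ξ.1) :=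
    contMDiff_proj _
  rw [← contMDiff_trivial_mk_iff hb]
  have h1 : ContMDiff (𝓘(ℝ, E).prod 𝓘(ℝ, F →L[ℝ] ℝ)) (𝓘(ℝ, E).prod 𝓘(ℝ, F →L[ℝ] ℝ)) ∞
      (fun ξ : 𝓛.DualSpace => TotalSpace.mk' (F →L[ℝ] ℝ)
        (E := fun x => V x →L[ℝ] Bundle.Trivial N ℝ x) ξ.1 ξ.2) := contMDiff_id
  exact h1.clm_bundle_apply ((𝓛.sectionsEquiv s).contMDiff.comp hb)

/-- Elements of the symmetric algebra define smooth functions on the dual bundle which are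
polynomial on the fibres. -/
theorem isSmoothFibrewisePolynomial_toFunctions
    (u : SymmetricAlgebra (SmoothFunctions E N) 𝓛.Sections) :
    𝓛.IsSmoothFibrewisePolynomial (𝓛.toFunctions u) := by
  induction u using SymmetricAlgebra.induction with
  | algebraMap a =>
    refine ⟨?_, 0, fun x => ⟨MvPolynomial.C (a x), by simp, fun ξ => ?_⟩⟩
    · have h : ContMDiff (𝓘(ℝ, E).prod 𝓘(ℝ, F →L[ℝ] ℝ)) 𝓘(ℝ, ℝ) ∞
          (fun ξ : 𝓛.DualSpace => a ξ.1) := a.contMDiff.comp (contMDiff_proj _)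
      exact h.congr fun ξ => 𝓛.toFunctions_algebraMap a ξ
    · rw [toFunctions_algebraMap, MvPolynomial.eval_C]
  | ι s =>
    refine ⟨?_, 1, fun x => ⟨MvPolynomial.X (𝓛.value s x), by simp, fun ξ => ?_⟩⟩
    · exact (𝓛.contMDiff_eval_section s).congr fun ξ => 𝓛.toFunctions_ι s ξ
    · rw [toFunctions_ι, MvPolynomial.eval_X]
  | mul u v hu hv =>
    obtain ⟨hu, d, hd⟩ := hu
    obtain ⟨hv, d', hd'⟩ := hv
    refine ⟨?_, d + d', fun x => ?_⟩
    · rw [map_mul]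
      exact hu.mul hv
    · obtain ⟨P, hP, hP'⟩ := hd x
      obtain ⟨Q, hQ, hQ'⟩ := hd' x
      refine ⟨P * Q, (MvPolynomial.totalDegree_mul _ _).trans (add_le_add hP hQ), fun ξ => ?_⟩
      rw [map_mul, map_mul, Pi.mul_apply, hP', hQ']
  | add u v hu hv =>
    obtain ⟨hu, d, hd⟩ := hu
    obtain ⟨hv, d', hd'⟩ := hv
    refine ⟨?_, max d d', fun x => ?_⟩
    · rw [map_add]
      exact hu.add hv
    · obtain ⟨P, hP, hP'⟩ := hd x
      obtain ⟨Q, hQ, hQ'⟩ := hd' x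
      refine ⟨P + Q, (MvPolynomial.totalDegree_add _ _).trans (max_le_max hP hQ), fun ξ => ?_⟩
      rw [map_add, map_add, Pi.add_apply, hP', hQ']

section DualFrame

variable {m : ℕ} {σ : ∀ x, V x →L[ℝ] Bundle.Trivial N (Fin m → ℝ) x}
  (hσ : ContMDiff 𝓘(ℝ, E) (𝓘(ℝ, E).prod 𝓘(ℝ, F →L[ℝ] (Fin m → ℝ))) ∞
    (fun x => TotalSpace.mk' (F →L[ℝ] (Fin m → ℝ))
      (E := fun x => V x →L[ℝ] Bundle.Trivial N (Fin m → ℝ) x) x (σ x)))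

/-- The coordinates of a section with respect to a smooth morphism to a trivial bundle. -/
noncomputable def coordinate (j : Fin m) : 𝓛.Sections →ₗ[SmoothFunctions E N] SmoothFunctions E N where
  toFun s := ⟨fun x => (show Fin m → ℝ from σ x (𝓛.value s x)) j, by
    have h : ContMDiff 𝓘(ℝ, E) 𝓘(ℝ, Fin m → ℝ) ∞
        (fun x => (show Fin m → ℝ from σ x (𝓛.value s x))) :=
      (contMDiff_trivial_mk_iff contMDiff_id).1
        (hσ.clm_bundle_apply (𝓛.sectionsEquiv s).contMDiff)
    exact (contMDiff_pi_space.1 h) j⟩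
  map_add' s t := by
    ext x
    exact congr_fun ((σ x).map_add (𝓛.value s x) (𝓛.value t x)) j
  map_smul' f s := by
    ext x
    exact congr_fun ((σ x).map_smul (f x) (𝓛.value s x)) j

/-- The linear form `∑ η_j σ_j` on a fibre. -/
noncomputable def dualCombination (σ : ∀ x, V x →L[ℝ] Bundle.Trivial N (Fin m → ℝ) x)
    (η : Fin m → ℝ) (x : N) : V x →L[ℝ] Bundle.Trivial N ℝ x :=
  (LinearMap.toContinuousLinearMap (Fintype.linearCombination ℝ η) : (Fin m → ℝ) →L[ℝ] ℝ) ∘L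
    (show V x →L[ℝ] (Fin m → ℝ) from σ x)

theorem dualCombination_apply (η : Fin m → ℝ) (x : N) (v : V x) :
    (dualCombination σ η x v : ℝ) = ∑ j, (show Fin m → ℝ from σ x v) j * η j := by
  simp [dualCombination, Fintype.linearCombination_apply]

-- Composing with these sections turns a smooth function on the dual bundle into smooth functions on
-- `N`, one for each `η`.
include hσ in
theorem contMDiff_dualCombination [FiniteDimensional ℝ F] (η : Fin m → ℝ) :
    ContMDiff 𝓘(ℝ, E) (𝓘(ℝ, E).prod 𝓘(ℝ, F →L[ℝ] ℝ)) ∞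
      (fun x => TotalSpace.mk' (F →L[ℝ] ℝ) (E := fun x => V x →L[ℝ] Bundle.Trivial N ℝ x) x
        (dualCombination σ η x)) := by
  intro x
  refine contMDiffAt_hom_of_symm fun v => contMDiffAt_totalSpace.2 ⟨contMDiffAt_id, ?_⟩
  have h := ((hσ x).clm_bundle_apply (contMDiffAt_symm_section (E := E) x v))
  have h2 := (contMDiffAt_totalSpace.1 h).2
  exact (ContinuousLinearMap.contMDiff (LinearMap.toContinuousLinearMap
    (Fintype.linearCombination ℝ η) : (Fin m → ℝ) →L[ℝ] ℝ)).contMDiffAt.comp x h2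

variable {e : Fin m → Cₛ^∞⟮𝓘(ℝ, E); F, V⟯}
  (he : ∀ x v, ∑ j, (show Fin m → ℝ from σ x v) j • e j x = v)

-- The frame identity makes $S_A[L]$ a retract of $A[X_1,\dots,X_m]$ through
-- $s\mapsto\sum\sigma_j(s)X_j$ and $X_j\mapsto e_j$, so it is enough that `Θ u` vanishes. This is
-- checked at each point of `N`, where a real polynomial with zero values is zero.
include hσ he in
theorem injective_toFunctions_of_dualFrame : Function.Injective 𝓛.toFunctions := by
  rw [injective_iff_map_eq_zero]
  intro u hu
  let Θ : SymmetricAlgebra (SmoothFunctions E N) 𝓛.Sections →ₐ[SmoothFunctions E N]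
      MvPolynomial (Fin m) (SmoothFunctions E N) :=
    SymmetricAlgebra.lift (∑ j, (LinearMap.toSpanSingleton (SmoothFunctions E N)
      (MvPolynomial (Fin m) (SmoothFunctions E N)) (MvPolynomial.X j)) ∘ₗ 𝓛.coordinate hσ j)
  let Ψ : MvPolynomial (Fin m) (SmoothFunctions E N) →ₐ[SmoothFunctions E N]
      SymmetricAlgebra (SmoothFunctions E N) 𝓛.Sections :=
    MvPolynomial.aeval fun j => SymmetricAlgebra.ι _ _ (𝓛.sectionsEquiv.symm (e j))
  have hΘι (s : 𝓛.Sections) : Θ (SymmetricAlgebra.ι _ _ s) =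
      ∑ j, 𝓛.coordinate hσ j s • MvPolynomial.X j := by
    simp [Θ, SymmetricAlgebra.lift_ι_apply]
  have hsum (s : 𝓛.Sections) (x : N) :
      𝓛.sectionsEquiv (∑ j, 𝓛.coordinate hσ j s • 𝓛.sectionsEquiv.symm (e j)) x =
        ∑ j, (show Fin m → ℝ from σ x (𝓛.value s x)) j • e j x := by
    rw [map_sum]
    change ContMDiffSection.coeAddHom _ _ _ _ (∑ j, _) x = _
    rw [map_sum, Finset.sum_apply]
    rfl
  have hΨΘ : Ψ.comp Θ = AlgHom.id _ _ := by
    refine SymmetricAlgebra.algHom_ext (LinearMap.ext fun s => ?_)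
    change Ψ (Θ (SymmetricAlgebra.ι _ _ s)) = SymmetricAlgebra.ι _ _ s
    simp only [hΘι, map_sum, map_smul, Ψ, MvPolynomial.aeval_X]
    simp only [← map_smul, ← map_sum]
    exact congr_arg _ (ContMDiffSection.ext fun x => (hsum s x).trans (he x (𝓛.value s x)))
  -- Evaluating the image polynomial at `x` and `η` is evaluating the function at the linear form
  -- $\sum\eta_j\sigma_j$ over `x`.
  have heval (x : N) (η : Fin m → ℝ)
      (w : SymmetricAlgebra (SmoothFunctions E N) 𝓛.Sections) :
      MvPolynomial.eval η (MvPolynomial.map (ContMDiffMap.evalRingHom (I := 𝓘(ℝ, E)) x) (Θ w)) =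
        𝓛.toFunctions w ⟨x, dualCombination σ η x⟩ := by
    induction w using SymmetricAlgebra.induction with
    | algebraMap a =>
      rw [AlgHom.commutes, MvPolynomial.algebraMap_eq, MvPolynomial.map_C, MvPolynomial.eval_C,
        toFunctions_algebraMap]
      rfl
    | ι s =>
      rw [toFunctions_ι, hΘι]
      refine Eq.trans ?_ (dualCombination_apply η x _).symm
      simp only [map_sum, MvPolynomial.smul_eq_C_mul, map_mul, MvPolynomial.map_C,
        MvPolynomial.map_X, MvPolynomial.eval_C, MvPolynomial.eval_X]
      rfl
    | mul w w' h h' => simp only [map_mul, h, h', Pi.mul_apply]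
    | add w w' h h' => simp only [map_add, h, h', Pi.add_apply]
  have hΘu : Θ u = 0 := by
    ext α x
    have h : MvPolynomial.map (ContMDiffMap.evalRingHom (I := 𝓘(ℝ, E)) x) (Θ u) = 0 :=
      MvPolynomial.funext fun η => by rw [heval, hu, map_zero]; rfl
    have h' := congr_arg (MvPolynomial.coeff α) h
    rw [MvPolynomial.coeff_map] at h'
    exact h'
  have := congr($hΨΘ u)
  rw [AlgHom.comp_apply, hΘu, map_zero] at this
  exact this.symm

-- Pulling `f` back to $N\times\mathbb R^m$ along $(x,\eta)\mapsto\sum\eta_j\sigma_j(x)$ gives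
-- polynomials in `η` with smooth coefficients. Substituting $X_j\mapsto e_j$ yields the preimage.
include hσ he in
theorem exists_toFunctions_eq_of_dualFrame [FiniteDimensional ℝ F] {f : 𝓛.DualSpace → ℝ}
    (hf : 𝓛.IsSmoothFibrewisePolynomial f) : ∃ u, 𝓛.toFunctions u = f := by
  obtain ⟨hsm, d, hd⟩ := hf
  choose P hPd hP using hd
  let q (x : N) (v : V x) : MvPolynomial (Fin m) ℝ :=
    ∑ j, MvPolynomial.C ((show Fin m → ℝ from σ x v) j) * MvPolynomial.X j
  have hq (x : N) (v : V x) : (q x v).totalDegree ≤ 1 := by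
    refine (MvPolynomial.totalDegree_finsetSum _ _).trans (Finset.sup_le fun j _ => ?_)
    refine (MvPolynomial.totalDegree_mul _ _).trans ?_
    simp
  -- The chosen `P x` is neither unique nor smooth in `x`, but its pullback `Q x` is determined by
  -- its values, hence by `f`, and all `Q x` lie in one finite-dimensional space.
  let Q (x : N) : MvPolynomial.restrictTotalDegree (Fin m) ℝ d :=
    ⟨MvPolynomial.aeval (q x) (P x), (MvPolynomial.mem_restrictTotalDegree _ _ _).2
      ((MvPolynomial.totalDegree_aeval_le_of_totalDegree_le_one _ _ (hq x)).trans (hPd x))⟩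
  have hQ (x : N) (η : Fin m → ℝ) :
      MvPolynomial.aeval η (Q x : MvPolynomial (Fin m) ℝ) = f ⟨x, dualCombination σ η x⟩ := by
    rw [hP]
    change MvPolynomial.aeval η (MvPolynomial.aeval (q x) (P x)) = _
    rw [← AlgHom.comp_apply, MvPolynomial.comp_aeval, ← MvPolynomial.coe_aeval_eq_eval]
    have : (fun v => MvPolynomial.aeval η (q x v)) =
        fun v => (dualCombination σ η x v : ℝ) := by
      funext v
      rw [dualCombination_apply]
      simp [q]
    rw [this]
    rfl
  let b := Module.finBasis ℝ (MvPolynomial.restrictTotalDegree (Fin m) ℝ d)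
  -- Each coordinate form is a linear combination of evaluations at points `η`, and these give
  -- smooth functions of `x`.
  have hsmooth (i) : ContMDiff 𝓘(ℝ, E) 𝓘(ℝ, ℝ) ∞ (fun x => b.coord i (Q x)) := by
    have hmem : b.coord i ∈ Submodule.span ℝ (Set.range fun η : Fin m → ℝ =>
        (MvPolynomial.aeval (R := ℝ) η).toLinearMap ∘ₗ
          (MvPolynomial.restrictTotalDegree (Fin m) ℝ d).subtype) := by
      rw [MvPolynomial.span_eval_restrictTotalDegree]
      trivial
    refine Submodule.span_induction (p := fun (l : Module.Dual ℝ _) _ =>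
      ContMDiff 𝓘(ℝ, E) 𝓘(ℝ, ℝ) ∞ (fun x => l (Q x))) ?_ ?_ ?_ ?_ hmem
    · rintro _ ⟨η, rfl⟩
      exact (hsm.comp (contMDiff_dualCombination hσ η)).congr fun x => hQ x η
    · exact contMDiff_const
    · intro l l' _ _ h h'
      exact h.add h'
    · intro c l _ h
      exact contMDiff_const.mul h
  let a (i) : SmoothFunctions E N := ⟨_, hsmooth i⟩
  let Φ : MvPolynomial (Fin m) ℝ →ₐ[ℝ] SymmetricAlgebra (SmoothFunctions E N) 𝓛.Sections :=
    MvPolynomial.aeval fun j => SymmetricAlgebra.ι _ _ (𝓛.sectionsEquiv.symm (e j))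
  have hΦ (p : MvPolynomial (Fin m) ℝ) (ξ : 𝓛.DualSpace) :
      𝓛.toFunctions (Φ p) ξ = MvPolynomial.aeval (fun j => (ξ.2 (e j ξ.1) : ℝ)) p := by
    induction p using MvPolynomial.induction_on with
    | C r =>
      rw [← MvPolynomial.algebraMap_eq, AlgHom.commutes, AlgHom.commutes,
        IsScalarTower.algebraMap_apply ℝ (SmoothFunctions E N), toFunctions_algebraMap]
      rfl
    | add p p' h h' => simp only [map_add, h, h', Pi.add_apply]
    | mul_X p j h =>
      simp only [map_mul, Pi.mul_apply, h, MvPolynomial.aeval_X, Φ]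
      rw [toFunctions_ι]
      rfl
  refine ⟨∑ i, algebraMap _ _ (a i) * Φ (b i : MvPolynomial (Fin m) ℝ), funext fun ξ => ?_⟩
  obtain ⟨x, ξ⟩ := ξ
  -- Applying `ξ` to $v=\sum\sigma_j(v)e_j$: every linear form arises from $\eta_j=\xi(e_j)$.
  have hξ : dualCombination σ (fun j => (ξ (e j x) : ℝ)) x = ξ := by
    ext v
    refine (dualCombination_apply _ x v).trans ?_
    conv_rhs => rw [← he x v]
    rw [map_sum]
    exact Finset.sum_congr rfl fun j _ => (ξ.map_smul _ _).symm
  conv_rhs => rw [← hξ, ← hQ, ← b.sum_repr (Q x)]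
  simp only [map_sum, map_mul, Finset.sum_apply, Pi.mul_apply, hΦ, toFunctions_algebraMap,
    Submodule.coe_sum, Submodule.coe_smul, map_smul, smul_eq_mul]
  rfl

end DualFrame

end LieAlgebroid

end LieAlgebroidTheory

end

/-! ### The main theorem -/

open Bundle Manifold LieAlgebroidTheory LieRinehartAlgebra in
open scoped ContDiff in
theorem mainTheorem5
    {E : Type*} [NormedAddCommGroup E] [NormedSpace ℝ E] [FiniteDimensional ℝ E]
    {N : Type*} [TopologicalSpace N] [T2Space N] [SigmaCompactSpace N]
    [ChartedSpace E N] [IsManifold 𝓘(ℝ, E) ∞ N]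
    {F : Type*} [NormedAddCommGroup F] [NormedSpace ℝ F] [FiniteDimensional ℝ F]
    {V : N → Type*} [TopologicalSpace (TotalSpace F V)] [∀ x, TopologicalSpace (V x)]
    [FiberBundle F V] [∀ x, AddCommGroup (V x)] [∀ x, Module ℝ (V x)] [VectorBundle ℝ F V]
    [ContMDiffVectorBundle ∞ F V 𝓘(ℝ, E)]
    (𝓛 : LieAlgebroid E F V)
    (r : ℕ) (hr : ∀ x, Module.finrank ℝ (LinearMap.range (𝓛.anchor.toFun x)) = r) :
    -- the image of the anchor is a foliation, and `L''` is the module of vector fields tangent to it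
    IsFoliation 𝓛.distribution ∧
    (∀ X : VectorFields E N, X ∈ 𝓛.anchorHom.image ↔ ∀ x, X x ∈ 𝓛.distribution x) ∧
    -- functions constant on the leaves are Casimirs of both tautological Poisson algebras
    (∀ f ∈ leafConstants 𝓛.distribution,
      (tautological ℝ (SmoothFunctions E N) 𝓛.Sections).IsCasimir (algebraMap _ _ f) ∧
      (tautological ℝ (SmoothFunctions E N) 𝓛.anchorHom.image).IsCasimir (algebraMap _ _ f)) ∧
    -- the extension `0 → L' → L → L'' → 0` admits a connection
    Nonempty (Connection 𝓛.anchorHom.toImage) ∧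
    -- for every connection, the Poisson bracket of the symmetric algebra of `L` is determined by the
    -- identities in terms of the connection and its curvature
    (∀ (w : Connection 𝓛.anchorHom.toImage)
      (P : PoissonBracket ℝ (SymmetricAlgebra (SmoothFunctions E N) 𝓛.Sections)),
      w.Describes P ↔ P = tautological ℝ (SmoothFunctions E N) 𝓛.Sections) ∧
    -- the symmetric algebra of `L` is the algebra of smooth functions on the total space of the dual
    -- bundle which are polynomial on the fibres
    Function.Injective 𝓛.toFunctions ∧
    Set.range 𝓛.toFunctions = {f | 𝓛.IsSmoothFibrewisePolynomial f} := by
  have hframe := exists_finite_dual_frame (E := E) (F := F) (V := V)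
  obtain ⟨m, e, σ, hσ, he⟩ := hframe
  refine ⟨𝓛.isFoliation_distribution hr, 𝓛.mem_image_anchorHom_iff hr,
    fun f hf => 𝓛.isCasimir_of_mem_leafConstants hf, 𝓛.nonempty_connection hr,
    fun w P => w.describes_iff P, 𝓛.injective_toFunctions_of_dualFrame hσ he,
    Set.eq_of_subset_of_subset ?_ fun f hf => 𝓛.exists_toFunctions_eq_of_dualFrame hσ he hf⟩
  rintro _ ⟨u, rfl⟩
  exact 𝓛.isSmoothFibrewisePolynomial_toFunctions u
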